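/- Let $N\ge 1$ and let $q\in\mathbb{C}^\times$ satisfy $q^{2N}\neq 1$ (so $q\neq\pm1$, and no pole is met at the evaluation point below). Write $[m]=(q^m-q^{-m})/(q-q^{-1})$ and let $\begin{bmatrix}N\\ r\end{bmatrix}$ be the symmetric Gaussian binomial coefficient $[N][N-1]\cdots[N-r+1]/([r][r-1]\cdots[1])$, understood as a Laurent polynomial in $q$. Let $\mathcal H=(\mathbb{C}^2)^{\otimes N}$. With respect to the basis $\uparrow\uparrow,\uparrow\downarrow,\downarrow\uparrow,\downarrow\downarrow$ of $\mathbb{C}^2\otimes\mathbb{C}^2$ put $$\check R(u)=\begin{pmatrix}1&0&0&0\\0&u\,g(u)&f(u)&0\\0&f(u)&g(u)&0\\0&0&0&1\end{pmatrix},\quad f(u)=\frac{u-1}{qu-q^{-1}},\quad g(u)=\frac{q-q^{-1}}{qu-q^{-1}},\qquad e=\begin{pmatrix}0&0&0&0\\0&q^{-1}&-1&0\\0&-1&q&0\\0&0&0&0\end{pmatrix},$$ and let $\check R_{k,k+1}(u)$, $e_{k,k+1}$ be these matrices acting on the tensor factors $k,k+1$ of $\mathcal H$. The evaluation is $\mathrm{ev}\colon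 z_j\mapsto e^{2\pi i j/N}$, $1\le j\le N$. **Spin-Macdonald operators.** For $J=\{j_1<\dots<j_r\}\subseteq\{1,\dots,N\}$ let $\hat p_J$ replace $z_j$ by $p\,z_j$ for all $j\in J$, let $A_J=\prod_{j\in J,\,k\notin J}\frac{q z_j-q^{-1}z_k}{z_j-z_k}$, and let $\check R_J(\mathbf z)=L_r\cdots L_2L_1$ be the product of $R$-matrices that transports the lines of $z_{j_1}$, then $z_{j_2}$, ..., then $z_{j_r}$ to the positions $1,\dots,r$. Here $L_m$ is the product, with $i\notin J$, $i<j_m$ increasing from left to right, of the matrices $\check R_{c,c+1}(z_i/z_{j_m})$ with $c=(m-1)+\#\{k\notin J: k\le i\}$. For $0\le r\le N$ define $$\widetilde D_r=\sum_{\#J=r}A_J\;\check R_J(\mathbf z)^{-1}\;\hat p_J\;\check R_J(\mathbf z),$$ acting on $\mathcal H[\mathbf z]=\mathcal H\otimes\mathbb{C}[z_1,\dots,z_N]$ with values in $\mathcal H$-valued rational functions; for instance $\widetilde D_1=\sum_j A_j\,\check R_{j-1,j}(z_j/z_{j-1})\cdots\check R_{12}(z_j/z_1)\,\hat p_j\,\check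 R_{12}(z_1/z_j)\cdots\check R_{j-1,j}(z_{j-1}/z_j)$ and $\widetilde D_N=\hat p_1\cdots\hat p_N$. The physical space $\widetilde{\mathcal H}\subset\mathcal H[\mathbf z]$ consists of the vectors $\Psi$ with $\check R_{k,k+1}(z_k/z_{k+1})\Psi=s_k\Psi$ for $1\le k<N$, where $s_k$ exchanges $z_k$ and $z_{k+1}$. **Pairwise Hamiltonians.** Let $V(x,y)=\dfrac{xy}{(qx-q^{-1}y)(qy-q^{-1}x)}$, and for $i<j$ $$S^{\mathrm L}_{[i,j]}=\check R_{j-1,j}(z_j/z_{j-1})\cdots\check R_{i+1,i+2}(z_j/z_{i+1})\;e_{i,i+1}\;\check R_{i+1,i+2}(z_{i+1}/z_j)\cdots\check R_{j-1,j}(z_{j-1}/z_j),$$ $$S^{\mathrm R}_{[i,j]}=\check R_{i,i+1}(z_{i+1}/z_i)\cdots\check R_{j-2,j-1}(z_{j-1}/z_i)\;e_{j-1,j}\;\check R_{j-2,j-1}(z_i/z_{j-1})\cdots\check R_{i,i+1}(z_i/z_{i+1}),$$ $$H^{\mathrm L}=\mathrm{ev}\,\frac{[N]}{N}\sum_{i<j}V(z_i,z_j)\,S^{\mathrm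 L}_{[i,j]},\qquad H^{\mathrm R}=\mathrm{ev}\,\frac{[N]}{N}\sum_{i<j}V(z_i,z_j)\,S^{\mathrm R}_{[i,j]}.$$ **Theorem.** For $1\le r\le N$ put $$\widetilde H_r=\frac1{q-q^{-1}}\,\frac{\partial}{\partial p}\bigg|_{p=1}\Bigl(\widetilde D_r-\frac rN\begin{bmatrix}N\\ r\end{bmatrix}\widetilde D_N\Bigr).$$ Then there is an operator $H_r=\mathrm{ev}\,\widetilde H_r$ on $\mathcal H$ such that $\mathrm{ev}(\widetilde H_r\Psi)=H_r\,\mathrm{ev}(\Psi)$ for all $\Psi\in\mathcal H[\mathbf z]$, and $H_r$ is the only operator on $\mathcal H$ for which this holds for all physical $\Psi$. Moreover $H_1=H^{\mathrm L}$, and $H_{N-1}=H^{\mathrm R}$ if $N\ge2$. -/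

import Mathlib

open scoped Matrix

namespace SpinChain

noncomputable section

/-! Sites are numbered `0, …, N - 1`: the index `k : Fin N` stands for the site `k + 1` of the
usual numbering `1, …, N`. -/

/-- Basis labels of `(ℂ²)^{⊗ N}`: the value `0` is spin up, the value `1` is spin down. -/
abbrev Spins (N : ℕ) : Type := Fin N → Fin 2

/-- The spin space `(ℂ²)^{⊗ N}`, in coordinates with respect to its standard basis. -/
abbrev SpinSpace (N : ℕ) : Type := Spins N → ℂ

/-- Operators on the spin space, as matrices in the standard basis. -/
abbrev SpinOp (N : ℕ) : Type := Matrix (Spins N) (Spins N) ℂ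

/-- Spin vectors with coefficients in `ℂ[z₁, …, z_N]`. -/
abbrev PolyVec (N : ℕ) : Type := Spins N → MvPolynomial (Fin N) ℂ

/-- The value of a polynomial vector at the point `z`. -/
def evalVec {N : ℕ} (Ψ : PolyVec N) (z : Fin N → ℂ) : SpinSpace N :=
  fun σ => MvPolynomial.eval z (Ψ σ)

/-- The evaluation point: `z_j = exp (2 π i j / N)` for `j = 1, …, N`. -/
def evPoint (N : ℕ) : Fin N → ℂ :=
  fun j => Complex.exp (2 * Real.pi * Complex.I * (((j : ℕ) : ℂ) + 1) / N)

/-! ### `q`-numbers -/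

/-- `[m] = (q^m - q^{-m}) / (q - q^{-1})`. -/
def qNum (q : ℂ) (m : ℤ) : ℂ := (q ^ m - q ^ (-m)) / (q - q⁻¹)

/-- The symmetric Gaussian binomial coefficient, a Laurent polynomial in `q`, through Pascal's
rule. This makes sense at roots of unity, too; see `prod_qNum_mul_qBinom` for the quotient formula. -/
def qBinom (q : ℂ) : ℕ → ℕ → ℂ
  | _, 0 => 1
  | 0, _ + 1 => 0
  | n + 1, k + 1 => q ^ (k + 1) * qBinom q n (k + 1) + q ^ ((k : ℤ) - n) * qBinom q n k

/-- `[k] ⋯ [2] [1]` times the binomial coefficient is `[n] [n - 1] ⋯ [n - k + 1]`. -/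
theorem prod_qNum_mul_qBinom (q : ℂ) (hq : q ≠ 0) (hq2 : q ^ 2 ≠ 1) (n k : ℕ) :
    (∏ s ∈ Finset.range k, qNum q ((s : ℤ) + 1)) * qBinom q n k
      = ∏ s ∈ Finset.range k, qNum q ((n : ℤ) - s) := by
  have hne : q - q⁻¹ ≠ 0 := by
    intro h
    apply hq2
    have h1 : q = q⁻¹ := sub_eq_zero.mp h
    rw [sq]
    nth_rewrite 2 [h1]
    exact mul_inv_cancel₀ hq
  induction n generalizing k with
  | zero =>
    cases k with
    | zero => simp [qBinom]
    | succ k =>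
      rw [Finset.prod_range_succ' (fun s : ℕ => qNum q (((0 : ℕ) : ℤ) - s))]
      simp [qBinom, qNum]
  | succ n ih =>
    cases k with
    | zero => simp [qBinom]
    | succ k =>
      have h1 := ih (k + 1)
      have h2 := ih k
      rw [Finset.prod_range_succ (fun s : ℕ => qNum q ((n : ℤ) - s))] at h1
      rw [Finset.prod_range_succ' (fun s : ℕ => qNum q (((n + 1 : ℕ) : ℤ) - s))]
      have h3 : ∀ s : ℕ, qNum q (((n + 1 : ℕ) : ℤ) - ((s + 1 : ℕ) : ℤ)) = qNum q ((n : ℤ) - s) := by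
        intro s
        congr 1
        push_cast
        ring
      have h4 : q ^ (k + 1) * qNum q ((n : ℤ) - k) + q ^ ((k : ℤ) - n) * qNum q ((k : ℤ) + 1)
          = qNum q (((n + 1 : ℕ) : ℤ) - ((0 : ℕ) : ℤ)) := by
        have e1 : q ^ (k + 1) = q ^ ((k : ℤ) + 1) := by
          exact_mod_cast (zpow_natCast q (k + 1)).symm
        have e2 : q ^ ((k : ℤ) + 1) * q ^ ((n : ℤ) - k) = q ^ ((n : ℤ) + 1) := by
          rw [← zpow_add₀ hq]; congr 1; ring
        have e3 : q ^ ((k : ℤ) + 1) * q ^ (-((n : ℤ) - k))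
            = q ^ ((k : ℤ) - n) * q ^ ((k : ℤ) + 1) := by
          rw [← zpow_add₀ hq, ← zpow_add₀ hq]; congr 1; ring
        have e4 : q ^ ((k : ℤ) - n) * q ^ (-((k : ℤ) + 1)) = q ^ (-((n : ℤ) + 1)) := by
          rw [← zpow_add₀ hq]; congr 1; ring
        have e5 : (((n + 1 : ℕ) : ℤ) - ((0 : ℕ) : ℤ)) = (n : ℤ) + 1 := by push_cast; ring
        rw [e1, e5]
        unfold qNum
        rw [← mul_div_assoc, ← mul_div_assoc, ← add_div, mul_sub, mul_sub, e2, e3, e4]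
        congr 1
        ring
      simp only [h3]
      rw [← h4, qBinom]
      rw [Finset.prod_range_succ] at h1 ⊢
      linear_combination q ^ (k + 1) * h1 + q ^ ((k : ℤ) - n) * qNum q ((k : ℤ) + 1) * h2

/-! ### Operators on one pair of neighbouring sites -/

/-- A `4 × 4` matrix, written in the basis `↑↑, ↑↓, ↓↑, ↓↓`, acting on the neighbouring sites
`k` and `k + 1` (and as the identity on the other sites). -/
def onPair (N k : ℕ) (M : Matrix (Fin 4) (Fin 4) ℂ) : SpinOp N :=
  if h : k + 1 < N then
    Matrix.of fun σ τ =>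
      if ∀ l : Fin N, (l : ℕ) ≠ k → (l : ℕ) ≠ k + 1 → σ l = τ l then
        M (finProdFinEquiv (σ ⟨k, by omega⟩, σ ⟨k + 1, h⟩))
          (finProdFinEquiv (τ ⟨k, by omega⟩, τ ⟨k + 1, h⟩))
      else 0
  else 1

/-- `f(u) = (u - 1) / (q u - q^{-1})`. -/
def fFun (q u : ℂ) : ℂ := (u - 1) / (q * u - q⁻¹)

/-- `g(u) = (q - q^{-1}) / (q u - q^{-1})`. -/
def gFun (q u : ℂ) : ℂ := (q - q⁻¹) / (q * u - q⁻¹)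

/-- The six-vertex `R`-matrix `Ř(u)`. -/
def Rcheck (q u : ℂ) : Matrix (Fin 4) (Fin 4) ℂ :=
  !![1, 0, 0, 0;
     0, u * gFun q u, fFun q u, 0;
     0, fFun q u, gFun q u, 0;
     0, 0, 0, 1]

/-- The Temperley–Lieb generator. -/
def eTL (q : ℂ) : Matrix (Fin 4) (Fin 4) ℂ :=
  !![0, 0, 0, 0;
     0, q⁻¹, -1, 0;
     0, -1, q, 0;
     0, 0, 0, 0]

/-! ### The two pairwise Hamiltonians -/

/-- The potential `V(x, y) = x y / ((q x - q^{-1} y) (q y - q^{-1} x))`. -/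
def potential (q x y : ℂ) : ℂ := x * y / ((q * x - q⁻¹ * y) * (q * y - q⁻¹ * x))

/-- The sites strictly between `i` and `j`, in increasing order. -/
def between {N : ℕ} (i j : Fin N) : List (Fin N) :=
  (List.finRange N).filter fun k => i < k ∧ k < j

/-- The long-range interaction `S^L_{[i,j]}`: the line of `z_j` is transported to the left until it
is next to `z_i`, interacts at the sites `i, i + 1`, and is transported back:
`Ř_{j-1,j}(z_j/z_{j-1}) ⋯ Ř_{i+1,i+2}(z_j/z_{i+1}) e_{i,i+1}
  Ř_{i+1,i+2}(z_{i+1}/z_j) ⋯ Ř_{j-1,j}(z_{j-1}/z_j)`. -/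
def SL {N : ℕ} (q : ℂ) (z : Fin N → ℂ) (i j : Fin N) : SpinOp N :=
  ((between i j).reverse.map fun k : Fin N => onPair N k (Rcheck q (z j / z k))).prod
    * onPair N i (eTL q)
    * ((between i j).map fun k : Fin N => onPair N k (Rcheck q (z k / z j))).prod

/-- The long-range interaction `S^R_{[i,j]}`: the line of `z_i` is transported to the right until it
is next to `z_j`, interacts at the sites `j - 1, j`, and is transported back:
`Ř_{i,i+1}(z_{i+1}/z_i) ⋯ Ř_{j-2,j-1}(z_{j-1}/z_i) e_{j-1,j}
  Ř_{j-2,j-1}(z_i/z_{j-1}) ⋯ Ř_{i,i+1}(z_i/z_{i+1})`. -/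
def SR {N : ℕ} (q : ℂ) (z : Fin N → ℂ) (i j : Fin N) : SpinOp N :=
  ((between i j).map fun k : Fin N => onPair N ((k : ℕ) - 1) (Rcheck q (z k / z i))).prod
    * onPair N ((j : ℕ) - 1) (eTL q)
    * ((between i j).reverse.map fun k : Fin N => onPair N ((k : ℕ) - 1) (Rcheck q (z i / z k))).prod

/-- `H^L = ([N]/N) ∑_{i<j} V(z_i, z_j) S^L_{[i,j]}` at the evaluation point. -/
def HL (N : ℕ) (q : ℂ) : SpinOp N :=
  (qNum q N / N) • ∑ i : Fin N, ∑ j ∈ Finset.Ioi i,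
    potential q (evPoint N i) (evPoint N j) • SL q (evPoint N) i j

/-- `H^R = ([N]/N) ∑_{i<j} V(z_i, z_j) S^R_{[i,j]}` at the evaluation point. -/
def HR (N : ℕ) (q : ℂ) : SpinOp N :=
  (qNum q N / N) • ∑ i : Fin N, ∑ j ∈ Finset.Ioi i,
    potential q (evPoint N i) (evPoint N j) • SR q (evPoint N) i j

/-! ### The spin-Macdonald operators -/

/-- `A_J = ∏_{j ∈ J, k ∉ J} (q z_j - q^{-1} z_k) / (z_j - z_k)`. -/
def coeffA {N : ℕ} (q : ℂ) (J : Finset (Fin N)) (z : Fin N → ℂ) : ℂ :=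
  ∏ j ∈ J, ∏ k ∈ Jᶜ, (q * z j - q⁻¹ * z k) / (z j - z k)

/-- The (`0`-based) left one of the two positions at which the line of `z_j`, `j ∈ J`, on its way to
the left crosses the line of `z_i`, `i ∉ J`: at that moment the lines with labels in `J` smaller
than `j`, followed by the lines with labels outside `J` smaller than `i`, are to the left. -/
def crossPos {N : ℕ} (J : Finset (Fin N)) (i j : Fin N) : ℕ :=
  (J.filter fun k => k < j).card + (Jᶜ.filter fun k => k < i).card

/-- The layer of `R`-matrices `Ř(z_i/z_j)` that moves the line of `z_j`, `j ∈ J`, to the left through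
the lines of all `z_i` with `i ∉ J`, `i < j`; the crossing with the largest `i` acts first. -/
def layer {N : ℕ} (q : ℂ) (J : Finset (Fin N)) (z : Fin N → ℂ) (j : Fin N) : SpinOp N :=
  (((List.finRange N).filter fun i => i ∉ J ∧ i < j).map fun i : Fin N =>
    onPair N (crossPos J i j) (Rcheck q (z i / z j))).prod

/-- The product of `R`-matrices (of the inverse Grassmannian permutation of `J = {j₁ < ⋯ < j_r}`)
that moves the lines of `z_{j₁}, …, z_{j_r}`, one after another, to the first `r` positions; the
layer of `j₁` acts first. -/
def RJ {N : ℕ} (q : ℂ) (J : Finset (Fin N)) (z : Fin N → ℂ) : SpinOp N :=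
  (((List.finRange N).filter fun j => j ∈ J).reverse.map (layer q J z)).prod

/-- `p̂_J`: replace `z_j` by `p z_j` for all `j ∈ J`. -/
def shift {N : ℕ} (p : ℂ) (J : Finset (Fin N)) (Φ : (Fin N → ℂ) → SpinSpace N) :
    (Fin N → ℂ) → SpinSpace N :=
  fun z => Φ fun k => if k ∈ J then p * z k else z k

/-- The spin-Macdonald operator `D̃_r = ∑_{#J = r} A_J Ř_J^{-1} p̂_J Ř_J`, acting on spin-valued
functions of `z`. -/
def spinMacdonald {N : ℕ} (q p : ℂ) (r : ℕ) (Φ : (Fin N → ℂ) → SpinSpace N) :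
    (Fin N → ℂ) → SpinSpace N :=
  fun z => ∑ J ∈ Finset.univ.powersetCard r,
    coeffA q J z • ((RJ q J z)⁻¹ *ᵥ shift p J (fun w => RJ q J w *ᵥ Φ w) z)

/-! ### Physical vectors and freezing -/

/-- The physical space: polynomial vectors with `Ř_{k,k+1}(z_k/z_{k+1}) Ψ = s_k Ψ` for all `k`,
where `s_k` exchanges `z_k` and `z_{k+1}`. -/
def physicalSpace (N : ℕ) (q : ℂ) : Set (PolyVec N) :=
  {Ψ | ∀ (k l : Fin N), (l : ℕ) = k + 1 → ∀ z : Fin N → ℂ,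
    z l ≠ 0 → q * z k ≠ q⁻¹ * z l →
      onPair N k (Rcheck q (z k / z l)) *ᵥ evalVec Ψ z = evalVec Ψ (z ∘ Equiv.swap k l)}

/-- The function `p ↦ (q - q^{-1})^{-1} (D̃_r - (r/N) [N choose r]_q D̃_N) Ψ`, evaluated at the point
`z`. Its derivative at `p = 1` is the value at `z` of `H̃_r Ψ`. -/
def modifiedMacdonald {N : ℕ} (q : ℂ) (r : ℕ) (Ψ : PolyVec N) (z : Fin N → ℂ) (p : ℂ) :
    SpinSpace N :=
  (q - q⁻¹)⁻¹ • (spinMacdonald q p r (evalVec Ψ) z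
    - ((r : ℂ) / N * qBinom q N r) • spinMacdonald q p N (evalVec Ψ) z)

/-- `H = ev H̃_r` on the set `X` of polynomial vectors: `H (ev Ψ) = ev (H̃_r Ψ)` for all `Ψ ∈ X`. -/
def IsFrozen {N : ℕ} (q : ℂ) (r : ℕ) (X : Set (PolyVec N)) (H : SpinOp N) : Prop :=
  ∀ Ψ ∈ X, HasDerivAt (modifiedMacdonald q r Ψ (evPoint N)) (H *ᵥ evalVec Ψ (evPoint N)) 1

end

end SpinChain

namespace SpinChain

/-! ### The Temperley–Lieb operators on the spin space -/

/-! Write $z_J(p)$ for the point whose coordinates in $J$ are scaled by $p$. At $p=1$ the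
$J$-summand of $\widetilde D_r\Psi$ has derivative $A_J(X_J\Psi+\sum_{j\in J}z_j\partial_j\Psi)$,
where $X_J$ is the logarithmic derivative of $p\mapsto\check R_J(z_J(p))$, a matrix independent of
$\Psi$. So only the derivatives of $\Psi$ could obstruct freezing, and $z_j\partial_j\Psi$ enters
with coefficient $\sum_{J\ni j}A_J$. At the evaluation point this is independent of $j$: rotating
the roots of unity permutes the coordinates cyclically, and $A_J$ is homogeneous of degree $0$.
Summing over $j$, its value is $\frac rN\sum_JA_J$, and $\sum_JA_J$ is the Gaussian binomial
(`sum_coeffA`, from scaled Vandermonde determinants). Since $\widetilde D_N$ contributes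
$\sum_jz_j\partial_j\Psi$ and no matrix, the subtraction removes all derivatives
(`isFrozen_frozenHamiltonian`), leaving $H_r=(q-q^{-1})^{-1}\sum_JA_JX_J$.

For $r=1$ and $r=N-1$ the product $\check R_J$ is a single string of $R$-matrices. The product rule
turns $X_J$ into a sum of conjugated logarithmic derivatives of single $R$-matrices. Each of these
is $(q-q^{-1})V$ times a Temperley–Lieb generator (`hasLogDeriv_onPair_Rcheck`), which gives
$S^{\mathrm L}$ and $S^{\mathrm R}$.

Uniqueness holds because physical vectors attain a nonzero multiple of every spin vector at the
evaluation point (`exists_physical`). By unitarity and the Yang–Baxter equation, the operators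
$\check R_{k,k+1}(z_{k+1}/z_k)s_k$ satisfy the relations of the symmetric group. Symmetrize $P(z)v$,
where $P$ vanishes at all nontrivial permutations of the evaluation point but not at the point
itself: only the identity term survives there. A power of a symmetric denominator makes the result
polynomial. -/

/-- The spins `σ` with those at the sites `k` and `k + 1` replaced by `a` and `b`. -/
def setPair {N : ℕ} (k : ℕ) (σ : Spins N) (a b : Fin 2) : Spins N :=
  fun l => if (l : ℕ) = k then a else if (l : ℕ) = k + 1 then b else σ l

/-- Only the spins at two sites are summed here, so that relations between local operators become
finite case checks. -/
theorem onPair_mulVec {N k : ℕ} (h : k + 1 < N) (M : Matrix (Fin 4) (Fin 4) ℂ) (v : SpinSpace N)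
    (σ : Spins N) :
    (onPair N k M *ᵥ v) σ = ∑ a : Fin 2, ∑ b : Fin 2,
      M (finProdFinEquiv (σ ⟨k, by omega⟩, σ ⟨k + 1, h⟩)) (finProdFinEquiv (a, b))
        * v (setPair k σ a b) := by
  rw [← Fintype.sum_prod_type', Matrix.mulVec, dotProduct]
  simp only [onPair, h, dif_pos, Matrix.of_apply, ite_mul, zero_mul]
  rw [← Finset.sum_filter]
  refine Finset.sum_nbij' (fun τ => (τ ⟨k, by omega⟩, τ ⟨k + 1, h⟩))
    (fun x => setPair k σ x.1 x.2) (by simp) ?_ ?_ ?_ ?_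
  · intro x _
    simp only [Finset.mem_filter, Finset.mem_univ, true_and, setPair]
    intro l h1 h2
    simp [h1, h2]
  · intro τ hτ
    simp only [Finset.mem_filter, Finset.mem_univ, true_and] at hτ
    funext l
    simp only [setPair]
    split_ifs with h1 h2
    · congr 1; exact Fin.ext h1.symm
    · congr 1; exact Fin.ext h2.symm
    · exact hτ l h1 h2
  · intro x _
    simp [setPair]
  · intro τ hτ
    simp only [Finset.mem_filter, Finset.mem_univ, true_and] at hτ
    congr 2
    funext l
    simp only [setPair]
    split_ifs with h1 h2
    · congr 1; exact Fin.ext h1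
    · congr 1; exact Fin.ext h2
    · exact (hτ l h1 h2).symm

/-- The Temperley–Lieb generator at the sites `k`, `k + 1`; zero if there are no such sites. -/
noncomputable def tl (N : ℕ) (q : ℂ) (k : ℕ) : SpinOp N :=
  if k + 1 < N then onPair N k (eTL q) else 0

/-- The diagonal entries are $1-q^{\mp1}f(u)$. At the pole this fails: division by zero makes
$f=g=0$, and both middle diagonal entries vanish. -/
theorem Rcheck_eq (q u : ℂ) (h : q * u - q⁻¹ ≠ 0) :
    Rcheck q u = 1 - fFun q u • eTL q := by
  have hf : fFun q u * (q * u - q⁻¹) = u - 1 := div_mul_cancel₀ _ h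
  have hg : gFun q u = 1 - q * fFun q u := by
    rw [gFun, div_eq_iff h]; linear_combination q * hf
  have hug : u * gFun q u = 1 - q⁻¹ * fFun q u := by
    rw [gFun, ← mul_div_assoc, div_eq_iff h]; linear_combination q⁻¹ * hf
  rw [Rcheck, hug, hg]
  ext i j
  fin_cases i <;> fin_cases j <;> simp [eTL, mul_comm]

/-- The default values match: without a site $k+1$, `onPair` is $1$ and `tl` is $0$, so no bound on
$k$ is required. -/
theorem onPair_Rcheck {N : ℕ} (k : ℕ) (q u : ℂ) (h : q * u - q⁻¹ ≠ 0) :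
    onPair N k (Rcheck q u) = 1 - fFun q u • tl N q k := by
  by_cases hk : k + 1 < N
  · rw [Rcheck_eq q u h]
    ext σ τ
    simp only [onPair, tl, hk, dif_pos, if_true, Matrix.of_apply, Matrix.sub_apply,
      Matrix.smul_apply, Matrix.one_apply, smul_eq_mul, EmbeddingLike.apply_eq_iff_eq,
      Prod.mk.injEq]
    by_cases hστ : σ = τ
    · subst hστ
      simp
    · by_cases hoff : ∀ l : Fin N, (l : ℕ) ≠ k → (l : ℕ) ≠ k + 1 → σ l = τ l
      · have : ¬ (σ ⟨k, by omega⟩ = τ ⟨k, by omega⟩ ∧ σ ⟨k + 1, hk⟩ = τ ⟨k + 1, hk⟩) := by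
          rintro ⟨h1, h2⟩
          apply hστ
          funext l
          by_cases hl : (l : ℕ) = k
          · have : l = ⟨k, by omega⟩ := Fin.ext hl
            rw [this, h1]
          · by_cases hl' : (l : ℕ) = k + 1
            · have : l = ⟨k + 1, hk⟩ := Fin.ext hl'
              rw [this, h2]
            · exact hoff l hl hl'
        simp only [if_pos hoff, if_neg hστ, if_neg this]
      · simp only [if_neg hoff, if_neg hστ]
        simp
  · simp [onPair, tl, hk]

theorem matrix_ext_mulVec {n : Type*} [Fintype n] [DecidableEq n] {A B : Matrix n n ℂ}
    (h : ∀ v, A *ᵥ v = B *ᵥ v) : A = B :=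
  Matrix.toLin'.injective (LinearMap.ext fun v => by simpa using h v)

theorem tl_mulVec {N k : ℕ} (h : k + 1 < N) (q : ℂ) (v : SpinSpace N) (σ : Spins N) :
    (tl N q k *ᵥ v) σ = ∑ a : Fin 2, ∑ b : Fin 2,
      eTL q (finProdFinEquiv (σ ⟨k, by omega⟩, σ ⟨k + 1, h⟩)) (finProdFinEquiv (a, b))
        * v (setPair k σ a b) := by
  rw [tl, if_pos h, onPair_mulVec h]

theorem tl_mul_tl_comm {N : ℕ} (q : ℂ) {k l : ℕ} (hkl : k + 1 < l) :
    tl N q k * tl N q l = tl N q l * tl N q k := by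
  by_cases hl : l + 1 < N
  swap
  · simp [tl, hl]
  have hk : k + 1 < N := by omega
  apply matrix_ext_mulVec
  intro v
  rw [← Matrix.mulVec_mulVec, ← Matrix.mulVec_mulVec]
  funext σ
  simp only [tl_mulVec hl, tl_mulVec hk]
  have e1 : ∀ a b c d, setPair l (setPair k σ a b) c d = setPair k (setPair l σ c d) a b := by
    intro a b c d
    funext m
    simp only [setPair]
    split_ifs <;> first | rfl | omega
  have e2 : ∀ a b, (setPair k σ a b) ⟨l, by omega⟩ = σ ⟨l, by omega⟩ := by
    intro a b
    simp only [setPair]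
    rw [if_neg (by omega), if_neg (by omega)]
  have e3 : ∀ a b, (setPair k σ a b) ⟨l + 1, by omega⟩ = σ ⟨l + 1, by omega⟩ := by
    intro a b
    simp only [setPair]
    rw [if_neg (by omega), if_neg (by omega)]
  have e4 : ∀ a b, (setPair l σ a b) ⟨k, by omega⟩ = σ ⟨k, by omega⟩ := by
    intro a b
    simp only [setPair]
    rw [if_neg (by omega), if_neg (by omega)]
  have e5 : ∀ a b, (setPair l σ a b) ⟨k + 1, by omega⟩ = σ ⟨k + 1, by omega⟩ := by
    intro a b
    simp only [setPair]
    rw [if_neg (by omega), if_neg (by omega)]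
  simp only [e1, e2, e3, e4, e5, Fin.sum_univ_two]
  ring

theorem tl_sq {N : ℕ} {q : ℂ} (hq : q ≠ 0) (k : ℕ) : tl N q k * tl N q k = (q + q⁻¹) • tl N q k := by
  by_cases hk : k + 1 < N
  swap
  · simp [tl, hk]
  apply matrix_ext_mulVec
  intro v
  rw [← Matrix.mulVec_mulVec, Matrix.smul_mulVec]
  funext σ
  simp only [tl_mulVec hk, Pi.smul_apply, smul_eq_mul]
  have e1 : ∀ a b c d, setPair k (setPair k σ a b) c d = setPair k σ c d := by
    intro a b c d
    funext m
    simp only [setPair]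
    split_ifs <;> rfl
  have e2 : ∀ a b, (setPair k σ a b) ⟨k, by omega⟩ = a := by intro a b; simp [setPair]
  have e3 : ∀ a b, (setPair k σ a b) ⟨k + 1, hk⟩ = b := by intro a b; simp [setPair]
  simp only [e1, e2, e3]
  generalize setPair k σ = w
  generalize σ ⟨k, by omega⟩ = s
  generalize σ ⟨k + 1, hk⟩ = t
  have hp : ∀ a b : Fin 2, finProdFinEquiv (a, b) = (⟨b + 2 * a, by omega⟩ : Fin 4) := fun _ _ => rfl
  fin_cases s <;> fin_cases t <;> simp [hp, eTL, Fin.sum_univ_two] <;>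
    (field_simp; try ring)

/-- The spins `σ` with those at the sites `k`, `k + 1`, `k + 2` replaced by `a`, `b`, `c`. -/
def setTriple {N : ℕ} (k : ℕ) (σ : Spins N) (a b c : Fin 2) : Spins N :=
  fun l => if (l : ℕ) = k then a else if (l : ℕ) = k + 1 then b else
    if (l : ℕ) = k + 2 then c else σ l

theorem tl_mulVec_setTriple {N k : ℕ} (h : k + 2 < N) (q : ℂ) (v : SpinSpace N) (σ : Spins N)
    (a b c : Fin 2) :
    (tl N q k *ᵥ v) (setTriple k σ a b c) = ∑ a' : Fin 2, ∑ b' : Fin 2,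
      eTL q (finProdFinEquiv (a, b)) (finProdFinEquiv (a', b')) * v (setTriple k σ a' b' c) := by
  rw [tl_mulVec (by omega)]
  have e1 : ∀ a' b', setPair k (setTriple k σ a b c) a' b' = setTriple k σ a' b' c := by
    intro a' b'
    funext m
    simp only [setPair, setTriple]
    split_ifs <;> rfl
  simp only [e1]
  simp [setTriple]

theorem tl_succ_mulVec_setTriple {N k : ℕ} (h : k + 2 < N) (q : ℂ) (v : SpinSpace N) (σ : Spins N)
    (a b c : Fin 2) :
    (tl N q (k + 1) *ᵥ v) (setTriple k σ a b c) = ∑ b' : Fin 2, ∑ c' : Fin 2,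
      eTL q (finProdFinEquiv (b, c)) (finProdFinEquiv (b', c')) * v (setTriple k σ a b' c') := by
  rw [tl_mulVec (by omega)]
  have e1 : ∀ b' c', setPair (k + 1) (setTriple k σ a b c) b' c' = setTriple k σ a b' c' := by
    intro a' b'
    funext m
    simp only [setPair, setTriple]
    split_ifs <;> first | rfl | omega
  simp only [e1]
  have e2 : setTriple k σ a b c ⟨k + 1 + 1, by omega⟩ = c := by
    simp only [setTriple]
    rw [if_neg (by omega), if_neg (by omega)]
    simp
  rw [e2]
  simp [setTriple]

theorem setTriple_self {N k : ℕ} (h : k + 2 < N) (σ : Spins N) :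
    setTriple k σ (σ ⟨k, by omega⟩) (σ ⟨k + 1, by omega⟩) (σ ⟨k + 2, h⟩) = σ := by
  funext l
  simp only [setTriple]
  split_ifs with h1 h2 h3
  · congr 1; exact Fin.ext h1.symm
  · congr 1; exact Fin.ext h2.symm
  · congr 1; exact Fin.ext h3.symm
  · rfl

theorem tl_mul_tl_succ_mul_tl {N k : ℕ} (h : k + 2 < N) {q : ℂ} (hq : q ≠ 0) :
    tl N q k * tl N q (k + 1) * tl N q k = tl N q k := by
  apply matrix_ext_mulVec
  intro v
  rw [← Matrix.mulVec_mulVec, ← Matrix.mulVec_mulVec]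
  funext σ
  -- Both operators only alter the three sites $k,k+1,k+2$, so the identity is a check over their
  -- eight spin values.
  rw [← setTriple_self h σ]
  simp only [tl_mulVec_setTriple h, tl_succ_mulVec_setTriple h]
  generalize σ ⟨k, by omega⟩ = a
  generalize σ ⟨k + 1, by omega⟩ = b
  generalize σ ⟨k + 2, by omega⟩ = c
  generalize setTriple k σ = w
  have hp : ∀ a b : Fin 2, finProdFinEquiv (a, b) = (⟨b + 2 * a, by omega⟩ : Fin 4) := fun _ _ => rfl
  fin_cases a <;> fin_cases b <;> fin_cases c <;> simp [hp, eTL, Fin.sum_univ_two] <;>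
    (field_simp; try ring)

theorem tl_succ_mul_tl_mul_tl_succ {N k : ℕ} (h : k + 2 < N) {q : ℂ} (hq : q ≠ 0) :
    tl N q (k + 1) * tl N q k * tl N q (k + 1) = tl N q (k + 1) := by
  apply matrix_ext_mulVec
  intro v
  rw [← Matrix.mulVec_mulVec, ← Matrix.mulVec_mulVec]
  funext σ
  rw [← setTriple_self h σ]
  simp only [tl_mulVec_setTriple h, tl_succ_mulVec_setTriple h]
  generalize σ ⟨k, by omega⟩ = a
  generalize σ ⟨k + 1, by omega⟩ = b
  generalize σ ⟨k + 2, by omega⟩ = c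
  generalize setTriple k σ = w
  have hp : ∀ a b : Fin 2, finProdFinEquiv (a, b) = (⟨b + 2 * a, by omega⟩ : Fin 4) := fun _ _ => rfl
  fin_cases a <;> fin_cases b <;> fin_cases c <;> simp [hp, eTL, Fin.sum_univ_two] <;>
    (field_simp; try ring)

/-! ### The `R`-matrices on the spin space -/

/-- `Ř_{k,k+1}(u)`, written through the Temperley–Lieb generator. -/
noncomputable def rOp (N : ℕ) (q : ℂ) (k : ℕ) (u : ℂ) : SpinOp N := 1 - fFun q u • tl N q k

theorem rOp_mul_rOp {N : ℕ} {q : ℂ} (hq : q ≠ 0) (k : ℕ) (u w : ℂ) :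
    rOp N q k u * rOp N q k w
      = 1 - (fFun q u + fFun q w - (q + q⁻¹) * (fFun q u * fFun q w)) • tl N q k := by
  simp only [rOp, sub_mul, mul_sub, one_mul, mul_one, smul_mul_assoc, mul_smul_comm, smul_smul,
    tl_sq hq]
  module

theorem rOp_mul_rOp_inv {N : ℕ} {q u : ℂ} (hq : q ≠ 0) (hu : u ≠ 0) (h1 : q * u - q⁻¹ ≠ 0)
    (h2 : q - q⁻¹ * u ≠ 0) (k : ℕ) : rOp N q k u * rOp N q k u⁻¹ = 1 := by
  have h3 : fFun q u⁻¹ = (1 - u) / (q - q⁻¹ * u) := by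
    rw [fFun, ← mul_div_mul_right _ _ hu, sub_mul, sub_mul, mul_assoc, inv_mul_cancel₀ hu]
    ring
  have : fFun q u + fFun q u⁻¹ - (q + q⁻¹) * (fFun q u * fFun q u⁻¹) = 0 := by
    rw [h3, fFun, div_mul_div_comm, div_add_div _ _ h1 h2, ← mul_div_assoc, ← sub_div]
    rw [div_eq_zero_iff]
    left
    ring
  rw [rOp_mul_rOp hq, this, zero_smul, sub_zero]

/-- This is the scalar content of the Yang–Baxter equation: the coefficient of a single generator on
its two sides. -/
theorem fFun_yangBaxter {q u w : ℂ} (hq : q ≠ 0) (h1 : q * u - q⁻¹ ≠ 0) (h2 : q * w - q⁻¹ ≠ 0)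
    (h3 : q * (u * w) - q⁻¹ ≠ 0) :
    fFun q u + fFun q w - (q + q⁻¹) * (fFun q u * fFun q w) + fFun q u * fFun q (u * w) * fFun q w
      = fFun q (u * w) := by
  have e1 : fFun q u * (q * u - q⁻¹) = u - 1 := div_mul_cancel₀ _ h1
  have e2 : fFun q w * (q * w - q⁻¹) = w - 1 := div_mul_cancel₀ _ h2
  have key : fFun q u + fFun q w - (q + q⁻¹) * (fFun q u * fFun q w)
      = fFun q (u * w) * (1 - fFun q u * fFun q w) := by
    have e3 : fFun q (u * w) * (q * (u * w) - q⁻¹) = u * w - 1 := div_mul_cancel₀ _ h3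
    have hrem : (u - 1) * (q * w - q⁻¹) * (q * (u * w) - q⁻¹)
        + (w - 1) * (q * u - q⁻¹) * (q * (u * w) - q⁻¹)
        - (q + q⁻¹) * ((u - 1) * (w - 1)) * (q * (u * w) - q⁻¹)
        - (u * w - 1) * ((q * u - q⁻¹) * (q * w - q⁻¹) - (u - 1) * (w - 1)) = 0 := by
      field_simp
      ring
    apply mul_left_cancel₀ (mul_ne_zero (mul_ne_zero h1 h2) h3)
    generalize fFun q u = a at *
    generalize fFun q w = c at *
    generalize fFun q (u * w) = b at *
    linear_combination hrem + ((q * w - q⁻¹) * (q * (u * w) - q⁻¹)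
        - (q + q⁻¹) * c * (q * w - q⁻¹) * (q * (u * w) - q⁻¹)
        + b * (q * (u * w) - q⁻¹) * c * (q * w - q⁻¹)) * e1
      + ((q * u - q⁻¹) * (q * (u * w) - q⁻¹) - (q + q⁻¹) * (u - 1) * (q * (u * w) - q⁻¹)
        + b * (q * (u * w) - q⁻¹) * (u - 1)) * e2
      - ((q * u - q⁻¹) * (q * w - q⁻¹) - (u - 1) * (w - 1)) * e3
  linear_combination key

/-- After expansion the products $e_ke_{k+1}$ and $e_{k+1}e_k$ have equal coefficients on both
sides. The Temperley–Lieb relations reduce all other terms to multiples of $1$, $e_k$ and $e_{k+1}$,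
and the difference is a multiple of $e_k-e_{k+1}$ that vanishes by `fFun_yangBaxter`. -/
theorem rOp_yangBaxter {N k : ℕ} (hk : k + 2 < N) {q u w : ℂ} (hq : q ≠ 0)
    (h1 : q * u - q⁻¹ ≠ 0) (h2 : q * w - q⁻¹ ≠ 0) (h3 : q * (u * w) - q⁻¹ ≠ 0) :
    rOp N q k u * rOp N q (k + 1) (u * w) * rOp N q k w
      = rOp N q (k + 1) w * rOp N q k (u * w) * rOp N q (k + 1) u := by
  have hf := fFun_yangBaxter hq h1 h2 h3
  have t1 := tl_mul_tl_succ_mul_tl hk hq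
  have t2 := tl_succ_mul_tl_mul_tl_succ hk hq
  have t3 := tl_sq (N := N) hq k
  have t4 := tl_sq (N := N) hq (k + 1)
  rw [mul_assoc] at t1 t2
  simp only [rOp, sub_mul, mul_sub, one_mul, mul_one, smul_mul_assoc, mul_smul_comm, smul_smul,
    mul_assoc, t1, t2, t3, t4]
  rw [← sub_eq_zero]
  generalize fFun q (u * w) = b at *
  linear_combination (norm := module) hf • tl N q (k + 1) - hf • tl N q k

end SpinChain

/-! ### Symmetrizers for involutions with braid relations -/

namespace SpinChain

section Symmetrizer

section AscProd

variable {A : Type*} [Monoid A] (g : ℕ → A)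


/-- The product `g j * g (j + 1) * ⋯ * g (n - 1)`; it is `1` for `n ≤ j`. -/
def ascProd (j : ℕ) : ℕ → A
  | 0 => 1
  | n + 1 => if j ≤ n then ascProd j n * g n else 1

theorem ascProd_self (n : ℕ) : ascProd g n n = 1 := by
  cases n <;> simp [ascProd]

theorem ascProd_succ {j n : ℕ} (h : j ≤ n) : ascProd g j (n + 1) = ascProd g j n * g n := by
  simp [ascProd, h]

theorem ascProd_eq_mul {j n : ℕ} (h : j < n) : ascProd g j n = g j * ascProd g (j + 1) n := by
  induction n with
  | zero => omega
  | succ n ih =>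
    rcases Nat.lt_succ_iff_lt_or_eq.mp h with h | rfl
    · rw [ascProd_succ g h.le, ascProd_succ g h, ih h, mul_assoc]
    · rw [ascProd_succ g le_rfl, ascProd_self, ascProd_self]; simp

end AscProd

variable {A : Type*} [Ring A] (g : ℕ → A)

/-- The sum of the products of the `g k`, `k < n`, over all permutations of `n + 1` letters. -/
def symmetrizer : ℕ → A
  | 0 => 1
  | n + 1 => (∑ j ∈ Finset.range (n + 2), ascProd g j (n + 1)) * symmetrizer n

variable {g} {n : ℕ}

theorem mul_ascProd_of_lt (hcomm : ∀ k l, k + 1 < l → l < n → g k * g l = g l * g k)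
    {k j m : ℕ} (hkj : k + 1 < j) (hm : m ≤ n) : g k * ascProd g j m = ascProd g j m * g k := by
  induction m with
  | zero => simp [ascProd]
  | succ m ih =>
    by_cases hj : j ≤ m
    · rw [ascProd_succ g hj, ← mul_assoc, ih (by omega), mul_assoc,
        hcomm k m (by omega) (by omega), mul_assoc]
    · simp [ascProd, hj]

/-- The factor $g_{k+1}$ commutes past everything before $g_kg_{k+1}$, the braid relation turns it
into $g_k$, and that commutes past the rest. -/
theorem mul_ascProd_of_gt (hcomm : ∀ k l, k + 1 < l → l < n → g k * g l = g l * g k)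
    (hbraid : ∀ k, k + 1 < n → g k * g (k + 1) * g k = g (k + 1) * g k * g (k + 1))
    {k j m : ℕ} (hjk : j ≤ k) (hkm : k + 1 < m) (hm : m ≤ n) :
    g (k + 1) * ascProd g j m = ascProd g j m * g k := by
  induction m with
  | zero => omega
  | succ m ih =>
    rcases Nat.lt_succ_iff_lt_or_eq.mp hkm with h | rfl
    · rw [ascProd_succ g (by omega), ← mul_assoc, ih h (by omega), mul_assoc,
        hcomm k m (by omega) (by omega), mul_assoc]
    · rw [ascProd_succ g (by omega), ascProd_succ g hjk, ← mul_assoc, ← mul_assoc]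
      have : g (k + 1) * ascProd g j k = ascProd g j k * g (k + 1) := by
        clear ih
        have aux : ∀ i, i ≤ k → g (k + 1) * ascProd g j i = ascProd g j i * g (k + 1) := by
          intro i hi
          induction i with
          | zero => simp [ascProd]
          | succ i ih =>
            by_cases hj : j ≤ i
            · rw [ascProd_succ g hj, ← mul_assoc, ih (by omega), mul_assoc,
                ← hcomm i (k + 1) (by omega) (by omega), mul_assoc]
            · simp [ascProd, hj]
        exact aux k le_rfl
      rw [this, mul_assoc, mul_assoc, ← mul_assoc (g (k + 1)), ← hbraid k (by omega)]
      simp only [mul_assoc]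

/-- The products `ascProd g j (m + 1)` stand for the coset representatives of the permutations of
$m+2$ letters modulo those of the first $m+1$. Left multiplication by $g_k$ exchanges the
representatives $k$ and $k+1$. Past any other representative it becomes a generator that the smaller
symmetrizer absorbs. -/
theorem mul_symmetrizer (hsq : ∀ k, k < n → g k * g k = 1)
    (hcomm : ∀ k l, k + 1 < l → l < n → g k * g l = g l * g k)
    (hbraid : ∀ k, k + 1 < n → g k * g (k + 1) * g k = g (k + 1) * g k * g (k + 1))
    {k m : ℕ} (hk : k < m) (hm : m ≤ n) : g k * symmetrizer g m = symmetrizer g m := by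
  induction m generalizing k with
  | zero => omega
  | succ m ih =>
    simp only [symmetrizer]
    rw [Finset.sum_mul, Finset.mul_sum]
    have hstep : ∀ j ∈ Finset.range (m + 2),
        g k * (ascProd g j (m + 1) * symmetrizer g m)
          = ascProd g (Equiv.swap k (k + 1) j) (m + 1) * symmetrizer g m := by
      intro j hj
      rw [Finset.mem_range] at hj
      rw [← mul_assoc]
      rcases lt_trichotomy j k with h | rfl | h
      · obtain ⟨k, rfl⟩ : ∃ k', k = k' + 1 := ⟨k - 1, by omega⟩
        rw [mul_ascProd_of_gt hcomm hbraid (by omega) (by omega) hm, mul_assoc,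
          ih (by omega) (by omega), Equiv.swap_apply_of_ne_of_ne (by omega) (by omega)]
      · rw [ascProd_eq_mul g hk, ← mul_assoc, hsq j (by omega), one_mul, Equiv.swap_apply_left]
      · by_cases h' : j = k + 1
        · subst h'
          rw [Equiv.swap_apply_right, ← ascProd_eq_mul g hk]
        · rw [mul_ascProd_of_lt hcomm (by omega) hm, mul_assoc, ih (by omega) (by omega),
            Equiv.swap_apply_of_ne_of_ne (by omega) (by omega)]
    rw [Finset.sum_congr rfl hstep]
    refine Finset.sum_nbij' (Equiv.swap k (k + 1)) (Equiv.swap k (k + 1)) ?_ ?_ ?_ ?_ ?_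
    · intro j hj
      simp only [Finset.mem_range, Equiv.swap_apply_def] at hj ⊢
      split_ifs <;> omega
    · intro j hj
      simp only [Finset.mem_range, Equiv.swap_apply_def] at hj ⊢
      split_ifs <;> omega
    · simp
    · simp
    · simp

end Symmetrizer

end SpinChain

namespace SpinChain

/-! ### The action of the symmetric group on spin-valued functions -/

/-- The points at which no `R`-matrix `Ř(z_i/z_j)` has a pole, and all coordinates are nonzero. -/
structure RegularPoint (N : ℕ) (q : ℂ) where
  /-- The coordinates. -/
  val : Fin N → ℂ
  ne' : ∀ i j, q * val i - q⁻¹ * val j ≠ 0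

namespace RegularPoint

variable {N : ℕ} {q : ℂ}

/-- Permutation of the coordinates. -/
def perm (z : RegularPoint N q) (w : Equiv.Perm (Fin N)) : RegularPoint N q :=
  ⟨z.val ∘ w, fun i j => z.ne' (w i) (w j)⟩

theorem perm_one (z : RegularPoint N q) : z.perm 1 = z := rfl

theorem perm_perm (z : RegularPoint N q) (w w' : Equiv.Perm (Fin N)) :
    (z.perm w).perm w' = z.perm (w * w') := rfl

theorem perm_val (z : RegularPoint N q) (w : Equiv.Perm (Fin N)) (i : Fin N) :
    (z.perm w).val i = z.val (w i) := rfl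

theorem ne_zero (z : RegularPoint N q) (i : Fin N) : z.val i ≠ 0 := by
  intro h
  -- The pole condition with $i=j$ is what excludes zero coordinates.
  apply z.ne' i i
  simp [h]

theorem ratio_ne (z : RegularPoint N q) (i j : Fin N) : q * (z.val i / z.val j) - q⁻¹ ≠ 0 := by
  have h := z.ne' i j
  have hj := z.ne_zero j
  intro h'
  apply h
  have : q * z.val i - q⁻¹ * z.val j = (q * (z.val i / z.val j) - q⁻¹) * z.val j := by
    field_simp
  rw [this, h', zero_mul]

theorem ratio_ne' (z : RegularPoint N q) (i j : Fin N) : q - q⁻¹ * (z.val i / z.val j) ≠ 0 := by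
  have h := z.ne' j i
  have hj := z.ne_zero j
  intro h'
  apply h
  have : q * z.val j - q⁻¹ * z.val i = (q - q⁻¹ * (z.val i / z.val j)) * z.val j := by
    field_simp
  rw [this, h', zero_mul]

end RegularPoint

/-- The exchange of the sites `k` and `k + 1`. -/
def siteSwap (N k : ℕ) : Equiv.Perm (Fin N) :=
  if h : k + 1 < N then Equiv.swap ⟨k, by omega⟩ ⟨k + 1, h⟩ else 1

theorem siteSwap_eq {N k : ℕ} (h : k + 1 < N) :
    siteSwap N k = Equiv.swap ⟨k, by omega⟩ ⟨k + 1, h⟩ := dif_pos h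

theorem siteSwap_apply_of_ne {N k : ℕ} {i : Fin N} (h1 : (i : ℕ) ≠ k) (h2 : (i : ℕ) ≠ k + 1) :
    siteSwap N k i = i := by
  unfold siteSwap
  split_ifs with h
  · exact Equiv.swap_apply_of_ne_of_ne (fun h => h1 (by simp [h])) (fun h => h2 (by simp [h]))
  · rfl

theorem siteSwap_left {N k : ℕ} (h : k + 1 < N) :
    siteSwap N k ⟨k, by omega⟩ = ⟨k + 1, h⟩ := by
  rw [siteSwap_eq h, Equiv.swap_apply_left]

theorem siteSwap_right {N k : ℕ} (h : k + 1 < N) :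
    siteSwap N k ⟨k + 1, h⟩ = ⟨k, by omega⟩ := by
  rw [siteSwap_eq h, Equiv.swap_apply_right]

theorem siteSwap_sq (N k : ℕ) : siteSwap N k * siteSwap N k = 1 := by
  unfold siteSwap
  split_ifs
  · exact Equiv.swap_mul_self _ _
  · simp

theorem siteSwap_comm {N k l : ℕ} (h : k + 1 < l) :
    siteSwap N k * siteSwap N l = siteSwap N l * siteSwap N k := by
  by_cases hl : l + 1 < N
  swap
  · simp [siteSwap, hl]
  apply Equiv.Perm.Disjoint.commute
  intro i
  by_cases h1 : (i : ℕ) ≠ k ∧ (i : ℕ) ≠ k + 1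
  · exact Or.inl (siteSwap_apply_of_ne h1.1 h1.2)
  · exact Or.inr (siteSwap_apply_of_ne (by omega) (by omega))

theorem siteSwap_braid {N k : ℕ} (h : k + 2 < N) :
    siteSwap N k * siteSwap N (k + 1) * siteSwap N k
      = siteSwap N (k + 1) * siteSwap N k * siteSwap N (k + 1) := by
  have h1 : (⟨k, by omega⟩ : Fin N) ≠ ⟨k + 1, by omega⟩ := by simp
  have h2 : (⟨k, by omega⟩ : Fin N) ≠ ⟨k + 1 + 1, by omega⟩ := by simp; omega
  have h3 : (⟨k + 1, by omega⟩ : Fin N) ≠ ⟨k + 1 + 1, by omega⟩ := by simp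
  rw [siteSwap_eq (show k + 1 < N by omega), siteSwap_eq (show k + 1 + 1 < N from h)]
  generalize (⟨k, by omega⟩ : Fin N) = a at *
  generalize (⟨k + 1, by omega⟩ : Fin N) = b at *
  generalize (⟨k + 1 + 1, by omega⟩ : Fin N) = c at *
  rw [Equiv.swap_mul_swap_mul_swap h1 h2, Equiv.swap_comm c a,
    ← Equiv.swap_mul_swap_mul_swap h3.symm h2.symm, Equiv.swap_comm b a, Equiv.swap_comm c b]

/-- `F ↦ Ř_{k,k+1}(z_{k+1}/z_k) s_k F`, on spin-valued functions. Its fixed points are the functions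
with `Ř_{k,k+1}(z_k/z_{k+1}) F = s_k F`. -/
noncomputable def exchange (N : ℕ) (q : ℂ) (k : ℕ) :
    Module.End ℂ (RegularPoint N q → SpinSpace N) where
  toFun F z := (if h : k + 1 < N then rOp N q k (z.val ⟨k + 1, h⟩ / z.val ⟨k, by omega⟩) else 1)
    *ᵥ F (z.perm (siteSwap N k))
  map_add' F G := by
    funext z
    exact Matrix.mulVec_add _ _ _
  map_smul' c F := by
    funext z
    exact Matrix.mulVec_smul (_ : SpinOp N) c _

variable {N : ℕ} {q : ℂ}

theorem exchange_apply {k : ℕ} (h : k + 1 < N) (F : RegularPoint N q → SpinSpace N)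
    (z : RegularPoint N q) :
    exchange N q k F z = rOp N q k (z.val ⟨k + 1, h⟩ / z.val ⟨k, by omega⟩)
      *ᵥ F (z.perm (siteSwap N k)) := by
  simp [exchange, h]

theorem exchange_sq (hq : q ≠ 0) {k : ℕ} (h : k + 1 < N) :
    exchange N q k * exchange N q k = 1 := by
  refine LinearMap.ext fun F => funext fun z => ?_
  have hR := rOp_mul_rOp_inv (N := N) hq
    (div_ne_zero (z.ne_zero ⟨k + 1, h⟩) (z.ne_zero ⟨k, by omega⟩)) (z.ratio_ne _ _)
    (z.ratio_ne' _ _) k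
  rw [inv_div] at hR
  rw [Module.End.mul_apply, exchange_apply h, exchange_apply h, Matrix.mulVec_mulVec,
    RegularPoint.perm_perm, siteSwap_sq, RegularPoint.perm_val, RegularPoint.perm_val,
    siteSwap_left h, siteSwap_right h, hR, Matrix.one_mulVec]
  rfl

theorem exchange_comm {k l : ℕ} (hkl : k + 1 < l) (h : l + 1 < N) :
    exchange N q k * exchange N q l = exchange N q l * exchange N q k := by
  refine LinearMap.ext fun F => funext fun z => ?_
  rw [Module.End.mul_apply, Module.End.mul_apply, exchange_apply (by omega), exchange_apply h,
    exchange_apply h, exchange_apply (by omega)]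
  simp only [Matrix.mulVec_mulVec, RegularPoint.perm_perm, siteSwap_comm hkl,
    RegularPoint.perm_val]
  rw [siteSwap_apply_of_ne (by simp; omega) (by simp; omega),
    siteSwap_apply_of_ne (by simp; omega) (by simp; omega),
    siteSwap_apply_of_ne (by simp; omega) (by simp; omega),
    siteSwap_apply_of_ne (by simp; omega) (by simp; omega)]
  congr 1
  simp only [rOp, sub_mul, mul_sub, one_mul, mul_one, smul_mul_assoc, mul_smul_comm,
    tl_mul_tl_comm q hkl]
  module

theorem exchange_braid (hq : q ≠ 0) {k : ℕ} (h : k + 2 < N) :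
    exchange N q k * exchange N q (k + 1) * exchange N q k
      = exchange N q (k + 1) * exchange N q k * exchange N q (k + 1) := by
  refine LinearMap.ext fun F => funext fun z => ?_
  have h1 : k + 1 < N := by omega
  have h2 : k + 1 + 1 < N := h
  have s1 : siteSwap N k ⟨k + 1 + 1, h2⟩ = ⟨k + 1 + 1, h2⟩ :=
    siteSwap_apply_of_ne (by simp; omega) (by simp)
  have s2 : siteSwap N (k + 1) ⟨k, by omega⟩ = ⟨k, by omega⟩ :=
    siteSwap_apply_of_ne (by simp) (by simp; omega)
  simp only [Module.End.mul_apply, exchange_apply h1, exchange_apply h2, Matrix.mulVec_mulVec,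
    RegularPoint.perm_perm, RegularPoint.perm_val, Equiv.Perm.mul_apply, siteSwap_left h1,
    siteSwap_right h1, siteSwap_left h2, siteSwap_right h2, s1, s2]
  rw [siteSwap_braid h]
  congr 1
  have e : z.val ⟨k + 1 + 1, h2⟩ / z.val ⟨k, by omega⟩
      = z.val ⟨k + 1, h1⟩ / z.val ⟨k, by omega⟩ * (z.val ⟨k + 1 + 1, h2⟩ / z.val ⟨k + 1, h1⟩) := by
    have := z.ne_zero ⟨k, by omega⟩
    have := z.ne_zero ⟨k + 1, h1⟩
    field_simp
  rw [e, ← mul_assoc, ← mul_assoc, rOp_yangBaxter h hq (z.ratio_ne _ _) (z.ratio_ne _ _) (by rw [← e]; exact z.ratio_ne _ _)]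

theorem exchange_symmetrizer (hq : q ≠ 0) {k : ℕ} (h : k + 1 < N)
    (F : RegularPoint N q → SpinSpace N) :
    exchange N q k (symmetrizer (exchange N q) (N - 1) F)
      = symmetrizer (exchange N q) (N - 1) F := by
  rw [← Module.End.mul_apply, mul_symmetrizer (n := N - 1) (fun k hk => exchange_sq hq (by omega))
    (fun k l hkl hl => exchange_comm hkl (by omega)) (fun k hk => exchange_braid hq (by omega))
    (by omega) le_rfl]

/-! ### Values of symmetrized functions -/

/-- The value at $z$ depends on $F$ at one permuted point only. The matrix can stay unspecified,
because it is only ever applied to a zero vector. -/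
theorem ascProd_exchange_apply (j m : ℕ) (z : RegularPoint N q) :
    ∃ M : SpinOp N, ∀ F, ascProd (exchange N q) j m F z
      = M *ᵥ F (z.perm (ascProd (siteSwap N) j m)) := by
  induction m with
  | zero => exact ⟨1, fun F => by simp [ascProd, RegularPoint.perm_one]⟩
  | succ m ih =>
    by_cases hj : j ≤ m
    · obtain ⟨M, hM⟩ := ih
      simp only [ascProd_succ _ hj, Module.End.mul_apply, hM]
      exact ⟨_, fun F => Matrix.mulVec_mulVec _ _ _⟩
    · exact ⟨1, fun F => by simp [ascProd, RegularPoint.perm_one, hj]⟩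

theorem ascProd_siteSwap_apply_of_gt {j m : ℕ} {i : Fin N} (h : m < (i : ℕ)) :
    ascProd (siteSwap N) j m i = i := by
  induction m with
  | zero => rfl
  | succ m ih =>
    by_cases hj : j ≤ m
    · rw [ascProd_succ _ hj, Equiv.Perm.mul_apply,
        siteSwap_apply_of_ne (by omega) (by omega), ih (by omega)]
    · simp [ascProd, hj]

theorem ascProd_siteSwap_apply_last {j m : ℕ} (hj : j ≤ m) (hm : m < N) :
    ascProd (siteSwap N) j m ⟨m, hm⟩ = ⟨j, by omega⟩ := by
  induction m with
  | zero =>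
    obtain rfl : j = 0 := by omega
    rfl
  | succ m ih =>
    by_cases hj : j ≤ m
    · rw [ascProd_succ _ hj, Equiv.Perm.mul_apply, siteSwap_right hm, ih hj]
    · obtain rfl : j = m + 1 := by omega
      rw [ascProd_self]; rfl

theorem symmetrizer_exchange_eq_zero {m : ℕ} {F : RegularPoint N q → SpinSpace N}
    {z : RegularPoint N q}
    (h : ∀ w : Equiv.Perm (Fin N), (∀ i : Fin N, m < (i : ℕ) → w i = i) → F (z.perm w) = 0) :
    symmetrizer (exchange N q) m F z = 0 := by
  induction m generalizing z with
  | zero =>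
    simpa [symmetrizer, RegularPoint.perm_one] using h 1 (fun _ _ => rfl)
  | succ m ih =>
    simp only [symmetrizer, Module.End.mul_apply, LinearMap.sum_apply, Finset.sum_apply]
    refine Finset.sum_eq_zero fun j _ => ?_
    obtain ⟨M, hM⟩ := ascProd_exchange_apply (N := N) (q := q) j (m + 1) z
    rw [hM, ih, Matrix.mulVec_zero]
    intro w hw
    rw [RegularPoint.perm_perm]
    refine h _ fun i hi => ?_
    rw [Equiv.Perm.mul_apply, hw i (by omega), ascProd_siteSwap_apply_of_gt hi]

/-- In the top layer, a representative $j\le m$ sends the letter $m+1$ to $j$, and the smaller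
symmetrizer does not move that letter. Hence all terms except the one with $j=m+1$ read $F$ at
nontrivial permutations. -/
theorem symmetrizer_exchange_apply {m : ℕ} (hm : m < N) {F : RegularPoint N q → SpinSpace N}
    {z : RegularPoint N q} (h : ∀ w : Equiv.Perm (Fin N), w ≠ 1 → F (z.perm w) = 0) :
    symmetrizer (exchange N q) m F z = F z := by
  induction m with
  | zero => simp [symmetrizer]
  | succ m ih =>
    simp only [symmetrizer, Module.End.mul_apply, LinearMap.sum_apply, Finset.sum_apply]
    rw [Finset.sum_range_succ, ascProd_self, Finset.sum_eq_zero, zero_add, Module.End.one_apply,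
      ih (by omega)]
    intro j hj
    rw [Finset.mem_range] at hj
    obtain ⟨M, hM⟩ := ascProd_exchange_apply (N := N) (q := q) j (m + 1) z
    rw [hM, symmetrizer_exchange_eq_zero, Matrix.mulVec_zero]
    intro w hw
    rw [RegularPoint.perm_perm]
    refine h _ fun h1 => ?_
    have h2 := congrArg (fun w : Equiv.Perm (Fin N) => w ⟨m + 1, hm⟩) h1
    simp only [Equiv.Perm.mul_apply, Equiv.Perm.one_apply] at h2
    rw [hw _ (by simp), ascProd_siteSwap_apply_last (by omega)] at h2
    have := congrArg Fin.val h2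
    simp only at this
    omega

end SpinChain

namespace SpinChain

variable {N : ℕ} {q : ℂ}

/-! ### Polynomiality up to a denominator -/

/-- The common denominator `∏_{i,j} (q z_i - q^{-1} z_j)`. -/
noncomputable def denom (N : ℕ) (q : ℂ) : MvPolynomial (Fin N) ℂ :=
  ∏ x : Fin N × Fin N,
    (MvPolynomial.C q * MvPolynomial.X x.1 - MvPolynomial.C q⁻¹ * MvPolynomial.X x.2)

theorem eval_denom (z : Fin N → ℂ) :
    MvPolynomial.eval z (denom N q) = ∏ x : Fin N × Fin N, (q * z x.1 - q⁻¹ * z x.2) := by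
  simp [denom, map_prod]

theorem eval_denom_comp (z : Fin N → ℂ) (w : Equiv.Perm (Fin N)) :
    MvPolynomial.eval (z ∘ w) (denom N q) = MvPolynomial.eval z (denom N q) := by
  rw [eval_denom, eval_denom]
  exact Fintype.prod_equiv (Equiv.prodCongr w w) _ _ (fun _ => rfl)

theorem RegularPoint.eval_denom_ne_zero (z : RegularPoint N q) :
    MvPolynomial.eval z.val (denom N q) ≠ 0 := by
  rw [eval_denom]
  exact Finset.prod_ne_zero_iff.mpr fun x _ => z.ne' _ _

/-- The functions on the regular points that become polynomials after multiplication by a power of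
the common denominator. -/
def fractions (N : ℕ) (q : ℂ) : Subalgebra ℂ (RegularPoint N q → ℂ) where
  carrier := {a | ∃ (M : ℕ) (p : MvPolynomial (Fin N) ℂ), ∀ z : RegularPoint N q,
    MvPolynomial.eval z.val p = MvPolynomial.eval z.val (denom N q) ^ M * a z}
  mul_mem' := by
    rintro a b ⟨M, p, hp⟩ ⟨M', p', hp'⟩
    refine ⟨M + M', p * p', fun z => ?_⟩
    rw [map_mul, hp, hp', Pi.mul_apply]
    ring
  add_mem' := by
    rintro a b ⟨M, p, hp⟩ ⟨M', p', hp'⟩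
    refine ⟨M + M', denom N q ^ M' * p + denom N q ^ M * p', fun z => ?_⟩
    rw [map_add, map_mul, map_mul, map_pow, map_pow, hp, hp', Pi.add_apply]
    ring
  algebraMap_mem' c := ⟨0, MvPolynomial.C c, fun z => by simp [Pi.algebraMap_apply]⟩

theorem eval_mem_fractions (p : MvPolynomial (Fin N) ℂ) :
    (fun z : RegularPoint N q => MvPolynomial.eval z.val p) ∈ fractions N q :=
  ⟨0, p, fun z => by simp⟩

theorem comp_perm_mem_fractions {a : RegularPoint N q → ℂ} (ha : a ∈ fractions N q)
    (w : Equiv.Perm (Fin N)) : (fun z : RegularPoint N q => a (z.perm w)) ∈ fractions N q := by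
  obtain ⟨M, p, hp⟩ := ha
  refine ⟨M, MvPolynomial.rename w p, fun z => ?_⟩
  rw [MvPolynomial.eval_rename, ← eval_denom_comp z.val w]
  exact hp (z.perm w)

theorem inv_mem_fractions (i j : Fin N) :
    (fun z : RegularPoint N q => (q * z.val i - q⁻¹ * z.val j)⁻¹) ∈ fractions N q := by
  refine ⟨1, ∏ x ∈ Finset.univ.erase (i, j),
    (MvPolynomial.C q * MvPolynomial.X x.1 - MvPolynomial.C q⁻¹ * MvPolynomial.X x.2),
    fun z => ?_⟩
  rw [pow_one, eval_denom, ← Finset.prod_erase_mul _ _ (Finset.mem_univ (i, j)),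
    mul_inv_cancel_right₀ (z.ne' i j)]
  simp [map_prod]

theorem fFun_mem_fractions (i j : Fin N) :
    (fun z : RegularPoint N q => fFun q (z.val i / z.val j)) ∈ fractions N q := by
  have h : (fun z : RegularPoint N q => fFun q (z.val i / z.val j))
      = (fun z : RegularPoint N q => MvPolynomial.eval z.val (MvPolynomial.X i - MvPolynomial.X j))
        * fun z => (q * z.val i - q⁻¹ * z.val j)⁻¹ := by
    funext z
    have hj := z.ne_zero j
    have h1 := z.ne' i j
    have h2 := z.ratio_ne i j
    simp only [Pi.mul_apply, map_sub, MvPolynomial.eval_X, fFun]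
    rw [← div_eq_mul_inv, div_eq_div_iff h2 h1]
    field_simp
  rw [h]
  exact mul_mem (eval_mem_fractions _) (inv_mem_fractions i j)

/-- The spin-valued functions whose components are polynomials up to a power of the common
denominator. -/
def spinFractions (N : ℕ) (q : ℂ) : Submodule ℂ (RegularPoint N q → SpinSpace N) where
  carrier := {F | ∀ σ, (fun z => F z σ) ∈ fractions N q}
  add_mem' hF hG σ := add_mem (hF σ) (hG σ)
  zero_mem' _ := zero_mem (fractions N q)
  smul_mem' c _ hF σ := Subalgebra.smul_mem _ (hF σ) c

theorem exchange_mem_spinFractions (k : ℕ) {F : RegularPoint N q → SpinSpace N}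
    (hF : F ∈ spinFractions N q) : exchange N q k F ∈ spinFractions N q := by
  intro σ
  by_cases h : k + 1 < N
  · have e : (fun z => exchange N q k F z σ) = (fun z => F (z.perm (siteSwap N k)) σ)
        - (fun z => fFun q (z.val ⟨k + 1, h⟩ / z.val ⟨k, by omega⟩)) *
          ∑ τ, tl N q k σ τ • fun z => F (z.perm (siteSwap N k)) τ := by
      funext z
      rw [exchange_apply h, rOp, Matrix.sub_mulVec, Matrix.one_mulVec, Matrix.smul_mulVec]
      simp [Matrix.mulVec, dotProduct]
    rw [e]
    exact sub_mem (comp_perm_mem_fractions (hF σ) _) (mul_mem (fFun_mem_fractions _ _)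
      (sum_mem fun τ _ => Subalgebra.smul_mem _ (comp_perm_mem_fractions (hF τ) _) _))
  · have e : exchange N q k F = F := by
      funext z
      simp [exchange, h, siteSwap, RegularPoint.perm_one]
    rw [e]
    exact hF σ

theorem ascProd_exchange_mem_spinFractions (j m : ℕ) {F : RegularPoint N q → SpinSpace N}
    (hF : F ∈ spinFractions N q) : ascProd (exchange N q) j m F ∈ spinFractions N q := by
  induction m generalizing F with
  | zero => simpa [ascProd] using hF
  | succ m ih =>
    by_cases hj : j ≤ m
    · rw [ascProd_succ _ hj, Module.End.mul_apply]
      exact ih (exchange_mem_spinFractions m hF)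
    · simpa [ascProd, hj] using hF

theorem symmetrizer_exchange_mem_spinFractions (m : ℕ) {F : RegularPoint N q → SpinSpace N}
    (hF : F ∈ spinFractions N q) : symmetrizer (exchange N q) m F ∈ spinFractions N q := by
  induction m with
  | zero => simpa [symmetrizer] using hF
  | succ m ih =>
    rw [symmetrizer, Module.End.mul_apply, LinearMap.sum_apply]
    exact sum_mem fun j _ => ascProd_exchange_mem_spinFractions j _ ih

theorem exists_polyVec {F : RegularPoint N q → SpinSpace N} (hF : F ∈ spinFractions N q) :
    ∃ (M : ℕ) (Ψ : PolyVec N), ∀ z : RegularPoint N q,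
      evalVec Ψ z.val = MvPolynomial.eval z.val (denom N q) ^ M • F z := by
  choose M p hp using hF
  refine ⟨∑ σ, M σ, fun σ => denom N q ^ (∑ τ ∈ Finset.univ.erase σ, M τ) * p σ,
    fun z => funext fun σ => ?_⟩
  rw [evalVec, map_mul, map_pow, hp, Pi.smul_apply, smul_eq_mul,
    ← Finset.sum_erase_add _ _ (Finset.mem_univ σ), pow_add, mul_assoc]

/-! ### Physical vectors with prescribed value -/

/-- Physicality is demanded wherever the one $R$-matrix in question has no pole, while
symmetrization controls only regular points. Clearing the denominator gives a polynomial $G$ that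
vanishes at regular points, so `denom N q * G σ` vanishes everywhere. The point `z₀` ensures that
the denominator is a nonzero polynomial. -/
theorem mem_physicalSpace (z₀ : RegularPoint N q) {Ψ : PolyVec N}
    (h : ∀ (k : ℕ) (hk : k + 1 < N) (z : RegularPoint N q),
      rOp N q k (z.val ⟨k, by omega⟩ / z.val ⟨k + 1, hk⟩) *ᵥ evalVec Ψ z.val
        = evalVec Ψ (z.val ∘ siteSwap N k)) : Ψ ∈ physicalSpace N q := by
  rintro ⟨k, hk'⟩ ⟨l, hl⟩ hkl z hzl hz
  obtain rfl : l = k + 1 := hkl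
  have hden : denom N q ≠ 0 := by
    intro h0
    apply z₀.eval_denom_ne_zero
    rw [h0, map_zero]
  let D : MvPolynomial (Fin N) ℂ := MvPolynomial.C q * MvPolynomial.X ⟨k, hk'⟩
    - MvPolynomial.C q⁻¹ * MvPolynomial.X ⟨k + 1, hl⟩
  let G : Spins N → MvPolynomial (Fin N) ℂ := fun σ =>
    D * (Ψ σ - MvPolynomial.rename (siteSwap N k) (Ψ σ))
      - (MvPolynomial.X ⟨k, hk'⟩ - MvPolynomial.X ⟨k + 1, hl⟩)
        * ∑ τ, MvPolynomial.C (tl N q k σ τ) * Ψ τ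
  have hG (y : Fin N → ℂ) (σ : Spins N) : MvPolynomial.eval y (G σ)
      = (q * y ⟨k, hk'⟩ - q⁻¹ * y ⟨k + 1, hl⟩)
          * (evalVec Ψ y σ - evalVec Ψ (y ∘ siteSwap N k) σ)
        - (y ⟨k, hk'⟩ - y ⟨k + 1, hl⟩) * (tl N q k *ᵥ evalVec Ψ y) σ := by
    simp [G, D, evalVec, MvPolynomial.eval_rename, Matrix.mulVec, dotProduct, map_sum]
  have key (y : Fin N → ℂ) (hy : y ⟨k + 1, hl⟩ ≠ 0)
      (hy' : q * y ⟨k, hk'⟩ - q⁻¹ * y ⟨k + 1, hl⟩ ≠ 0) (σ : Spins N) :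
      (rOp N q k (y ⟨k, hk'⟩ / y ⟨k + 1, hl⟩) *ᵥ evalVec Ψ y) σ = evalVec Ψ (y ∘ siteSwap N k) σ
        ↔ MvPolynomial.eval y (G σ) = 0 := by
    have hf : fFun q (y ⟨k, hk'⟩ / y ⟨k + 1, hl⟩)
        = (y ⟨k, hk'⟩ - y ⟨k + 1, hl⟩) / (q * y ⟨k, hk'⟩ - q⁻¹ * y ⟨k + 1, hl⟩) := by
      rw [fFun, ← mul_div_mul_right _ _ hy, sub_mul, sub_mul, mul_assoc, div_mul_cancel₀ _ hy,
        one_mul]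
    rw [hG, rOp, Matrix.sub_mulVec, Matrix.one_mulVec, Matrix.smul_mulVec, hf, Pi.sub_apply,
      Pi.smul_apply, smul_eq_mul, ← sub_eq_zero]
    rw [show ∀ a b c d e : ℂ, d ≠ 0 → (a - b / d * c - e = 0 ↔ d * (a - e) - b * c = 0) from ?_]
    · exact hy'
    · intro a b c d e hd
      rw [← mul_right_inj' hd, mul_zero]
      have : d * (a - b / d * c - e) = d * (a - e) - b * c := by
        field_simp
        ring
      rw [this]
  have hG0 (σ : Spins N) : G σ = 0 := by
    have : denom N q * G σ = 0 := by
      apply MvPolynomial.funext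
      intro y
      rw [map_mul, map_zero]
      by_cases hy : ∀ i j, q * y i - q⁻¹ * y j ≠ 0
      · let y' : RegularPoint N q := ⟨y, hy⟩
        rw [(key y (y'.ne_zero _) (hy _ _) σ).mp (congrFun (h k hl y') σ), mul_zero]
      · push Not at hy
        obtain ⟨i, j, hij⟩ := hy
        rw [eval_denom, Finset.prod_eq_zero (Finset.mem_univ (i, j)) hij, zero_mul]
    exact (mul_eq_zero.mp this).resolve_left hden
  have hz' := sub_ne_zero.mpr hz
  funext σ
  have h1 := (key z hzl hz' σ).mpr (by rw [hG0, map_zero])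
  rw [siteSwap_eq hl] at h1
  rw [onPair_Rcheck, ← h1]
  · rfl
  · intro h0
    apply hz'
    have : q * z ⟨k, hk'⟩ - q⁻¹ * z ⟨k + 1, hl⟩
        = (q * (z ⟨k, hk'⟩ / z ⟨k + 1, hl⟩) - q⁻¹) * z ⟨k + 1, hl⟩ := by
      rw [sub_mul, mul_assoc, div_mul_cancel₀ _ hzl]
    rw [this, h0, zero_mul]

theorem exists_physical (hN : 1 ≤ N) (hq : q ≠ 0) (z₀ : RegularPoint N q)
    (hinj : Function.Injective z₀.val) (v : SpinSpace N) :
    ∃ Ψ ∈ physicalSpace N q, ∃ c : ℂ, c ≠ 0 ∧ evalVec Ψ z₀.val = c • v := by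
  -- A nontrivial $w$ has some $w(i)\ne i$, and then the factor with indices $i$ and $w(i)$ vanishes
  -- at the permuted point. At `z₀` itself all factors are nonzero, as its coordinates are distinct.
  let P : MvPolynomial (Fin N) ℂ := ∏ i, ∏ j ∈ Finset.univ.erase i,
    (MvPolynomial.X i - MvPolynomial.C (z₀.val j))
  have hP (z : Fin N → ℂ) : MvPolynomial.eval z P
      = ∏ i, ∏ j ∈ Finset.univ.erase i, (z i - z₀.val j) := by
    simp [P, map_prod]
  let F : RegularPoint N q → SpinSpace N := fun z => MvPolynomial.eval z.val P • v
  have hF : F ∈ spinFractions N q := by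
    intro σ
    have : (fun z => F z σ) = v σ • fun z : RegularPoint N q => MvPolynomial.eval z.val P := by
      funext z
      simp [F, mul_comm]
    rw [this]
    exact Subalgebra.smul_mem _ (eval_mem_fractions _) _
  obtain ⟨M, Ψ, hΨ⟩ := exists_polyVec (symmetrizer_exchange_mem_spinFractions (N - 1) hF)
  refine ⟨Ψ, mem_physicalSpace z₀ fun k hk z => ?_, ?_⟩
  · have h1 := congrFun (exchange_symmetrizer hq hk F) (z.perm (siteSwap N k))
    rw [exchange_apply hk, RegularPoint.perm_perm, siteSwap_sq, RegularPoint.perm_one,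
      RegularPoint.perm_val, RegularPoint.perm_val, siteSwap_left hk, siteSwap_right hk] at h1
    have h2 := hΨ (z.perm (siteSwap N k))
    rw [← h1] at h2
    -- The denominator is symmetric, so both sides of the exchange condition carry the same scalar
    -- factor.
    rw [hΨ z, Matrix.mulVec_smul, ← eval_denom_comp z.val (siteSwap N k)]
    exact h2.symm
  · refine ⟨MvPolynomial.eval z₀.val (denom N q) ^ M * MvPolynomial.eval z₀.val P,
      mul_ne_zero (pow_ne_zero _ z₀.eval_denom_ne_zero) ?_, ?_⟩
    · rw [hP]
      refine Finset.prod_ne_zero_iff.mpr fun i _ => Finset.prod_ne_zero_iff.mpr fun j hj => ?_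
      exact sub_ne_zero.mpr fun h => (Finset.mem_erase.mp hj).1 (hinj h).symm
    · rw [hΨ, symmetrizer_exchange_apply (by omega), mul_smul]
      intro w hw
      obtain ⟨i, hi⟩ : ∃ i, w i ≠ i := by
        by_contra! h
        exact hw (Equiv.ext h)
      have : MvPolynomial.eval (z₀.perm w).val P = 0 := by
        rw [hP]
        refine Finset.prod_eq_zero (Finset.mem_univ i) (Finset.prod_eq_zero
          (Finset.mem_erase.mpr ⟨hi, Finset.mem_univ (w i)⟩) ?_)
        rw [RegularPoint.perm_val, sub_self]
      simp only [F, this, zero_smul]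

end SpinChain

namespace SpinChain

/-! ### The sum of the coefficients of the spin-Macdonald operators -/

theorem sum_powersetCard_insert_prod {ι R : Type*} [DecidableEq ι] [CommSemiring R] {a : ι}
    {s : Finset ι} (ha : a ∉ s) (f : ι → R) (r : ℕ) :
    ∑ J ∈ (insert a s).powersetCard (r + 1), ∏ i ∈ J, f i
      = (∑ J ∈ s.powersetCard (r + 1), ∏ i ∈ J, f i)
        + f a * ∑ J ∈ s.powersetCard r, ∏ i ∈ J, f i := by
  have hn : ∀ {m : ℕ} {J}, J ∈ s.powersetCard m → a ∉ J := fun hJ h =>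
    ha ((Finset.mem_powersetCard.mp hJ).1 h)
  rw [Finset.powersetCard_succ_insert ha, Finset.sum_union, Finset.sum_image, Finset.mul_sum]
  · congr 1
    exact Finset.sum_congr rfl fun J hJ => Finset.prod_insert (hn hJ)
  · intro J hJ J' hJ' h
    rw [← Finset.erase_insert (hn hJ), ← Finset.erase_insert (hn hJ'), h]
  · rw [Finset.disjoint_left]
    intro J hJ hJ'
    obtain ⟨J', _, rfl⟩ := Finset.mem_image.mp hJ'
    exact hn hJ (Finset.mem_insert_self _ _)

/-- Splitting off the index $0$ from the elementary symmetric polynomial of $1,q^2,\dots,q^{2(n-1)}$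
reproduces the Pascal rule that defines `qBinom`. -/
theorem sum_powersetCard_prod_pow {q : ℂ} (hq : q ≠ 0) (n r : ℕ) :
    ∑ J ∈ (Finset.univ : Finset (Fin n)).powersetCard r, ∏ i ∈ J, (q ^ 2) ^ (i : ℕ)
      = q ^ ((r : ℤ) * (n - 1)) * qBinom q n r := by
  induction n generalizing r with
  | zero =>
    cases r with
    | zero => simp [qBinom]
    | succ r =>
      rw [Finset.powersetCard_eq_empty.mpr (by simp)]
      simp [qBinom]
  | succ n ih =>
    cases r with
    | zero => simp [qBinom]
    | succ r =>
      have hmap (m : ℕ) : ∑ J ∈ (Finset.univ.map (Fin.succEmb n)).powersetCard m,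
          ∏ i ∈ J, (q ^ 2) ^ (i : ℕ) = (q ^ 2) ^ m * (q ^ ((m : ℤ) * (n - 1)) * qBinom q n m) := by
        rw [← ih, Finset.powersetCard_map, Finset.sum_map, Finset.mul_sum]
        refine Finset.sum_congr rfl fun J hJ => ?_
        simp [Finset.mapEmbedding_apply, Finset.prod_map, pow_succ, Finset.prod_mul_distrib,
          (Finset.mem_powersetCard.mp hJ).2, mul_comm]
      have huniv : (Finset.univ : Finset (Fin (n + 1)))
          = insert 0 (Finset.univ.map (Fin.succEmb n)) := by
        rw [Fin.univ_succ, Finset.cons_eq_insert]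
        rfl
      rw [huniv, sum_powersetCard_insert_prod (by simp), hmap, hmap, qBinom]
      have hp (m : ℕ) : (q ^ 2) ^ m = q ^ (2 * m : ℤ) := by
        rw [← pow_mul, ← zpow_natCast]
        push_cast
        rfl
      have e1 : (q ^ 2) ^ (r + 1) * q ^ (((r + 1 : ℕ) : ℤ) * (n - 1))
          = q ^ (((r + 1 : ℕ) : ℤ) * ((n + 1 : ℕ) - 1)) * q ^ (r + 1) := by
        rw [hp, ← zpow_natCast q (r + 1), ← zpow_add₀ hq, ← zpow_add₀ hq]
        congr 1
        push_cast
        ring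
      have e2 : (q ^ 2) ^ r * q ^ ((r : ℤ) * (n - 1))
          = q ^ (((r + 1 : ℕ) : ℤ) * ((n + 1 : ℕ) - 1)) * q ^ ((r : ℤ) - n) := by
        rw [hp, ← zpow_add₀ hq, ← zpow_add₀ hq]
        congr 1
        push_cast
        ring
      rw [Fin.val_zero, pow_zero, one_mul]
      linear_combination qBinom q n (r + 1) * e1 + qBinom q n r * e2

theorem det_vandermonde_scale {N : ℕ} {q : ℂ} (hq : q ≠ 0) {z : Fin N → ℂ}
    (hz : Function.Injective z) (J : Finset (Fin N)) :
    (Matrix.vandermonde fun i => if i ∈ J then q ^ 2 * z i else z i).det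
      = q ^ (J.card * (N - 1)) * coeffA q J z * (Matrix.vandermonde z).det := by
  let a : Fin N → Fin N → ℂ := fun i j => (q * z i - q⁻¹ * z j) / (z i - z j)
  -- The Vandermonde factor of a pair $i,j$ is multiplied by `k i j * k j i`: by $q^2$ if both lie
  -- in $J$, by $q$ times a factor of $A_J$ if exactly one does, by $1$ otherwise.
  let k : Fin N → Fin N → ℂ := fun i j => if i ∈ J then q * (if j ∈ J then 1 else a i j) else 1
  have h1 : ∏ i, ∏ j ∈ Finset.Ioi i, k i j * k j i = q ^ (J.card * (N - 1)) * coeffA q J z := by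
    rw [Finset.prod_prod_Ioi_mul_eq_prod_prod_off_diag fun i j => k j i]
    have : ∀ i, ∏ j ∈ {i}ᶜ, k i j = if i ∈ J then q ^ (N - 1) * ∏ j ∈ Jᶜ, a i j else 1 := by
      intro i
      split_ifs with hi
      · simp only [k, if_pos hi, Finset.prod_mul_distrib, Finset.prod_const, Finset.card_compl,
          Finset.card_singleton, Fintype.card_fin]
        congr 1
        rw [Finset.prod_ite, Finset.prod_const_one, one_mul]
        refine Finset.prod_congr (Finset.ext fun j => ?_) fun _ _ => rfl
        simp only [Finset.mem_filter, Finset.mem_compl, Finset.mem_singleton, and_iff_right_iff_imp]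
        rintro hj rfl
        exact hj hi
      · exact Finset.prod_eq_one fun j _ => by simp [k, hi]
    simp only [this]
    rw [Finset.prod_ite_mem, Finset.univ_inter, Finset.prod_mul_distrib, Finset.prod_const,
      ← pow_mul, mul_comm (N - 1)]
    rfl
  rw [Matrix.det_vandermonde, Matrix.det_vandermonde, ← h1, ← Finset.prod_mul_distrib]
  refine Finset.prod_congr rfl fun i _ => ?_
  rw [← Finset.prod_mul_distrib]
  refine Finset.prod_congr rfl fun j hj => ?_
  have hij : z i - z j ≠ 0 :=
    sub_ne_zero.mpr fun h => (Finset.mem_Ioi.mp hj).ne (hz h)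
  have hji : z j - z i ≠ 0 := fun h => hij (by linear_combination -h)
  by_cases hi : i ∈ J <;> by_cases hj : j ∈ J <;> simp only [k, a, hi, hj, if_true, if_false] <;>
    (field_simp; try ring)

/-- In the Leibniz expansion, scaling $J$ multiplies the term of $\sigma$ by $\prod_{i\in
J}q^{2\sigma(i)}$. Summed over all $J$ of size $r$, this no longer depends on $\sigma$. -/
theorem sum_det_vandermonde_scale {N : ℕ} (q : ℂ) (z : Fin N → ℂ) (r : ℕ) :
    ∑ J ∈ Finset.univ.powersetCard r,
        (Matrix.vandermonde fun i => if i ∈ J then q ^ 2 * z i else z i).det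
      = (∑ J ∈ (Finset.univ : Finset (Fin N)).powersetCard r, ∏ i ∈ J, (q ^ 2) ^ (i : ℕ))
        * (Matrix.vandermonde z).det := by
  have hσ (σ : Equiv.Perm (Fin N)) : ∑ J ∈ (Finset.univ : Finset (Fin N)).powersetCard r, ∏ i ∈ J, (q ^ 2) ^ (i : ℕ)
      = ∑ J ∈ (Finset.univ : Finset (Fin N)).powersetCard r, ∏ i ∈ J, (q ^ 2) ^ (σ i : ℕ) := by
    conv_lhs => rw [← Finset.map_univ_equiv σ, Finset.powersetCard_map, Finset.sum_map]
    simp [Finset.mapEmbedding_apply, Finset.prod_map]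
  simp only [← Matrix.det_transpose (Matrix.vandermonde _), Matrix.det_apply, Finset.mul_sum]
  rw [Finset.sum_comm]
  refine Finset.sum_congr rfl fun σ _ => ?_
  have (J : Finset (Fin N)) (i : Fin N) : (if i ∈ J then q ^ 2 * z i else z i)
      = (if i ∈ J then q ^ 2 else 1) * z i := by
    split_ifs <;> simp
  simp only [Matrix.transpose_apply, Matrix.vandermonde_apply, this, mul_pow,
    Finset.prod_mul_distrib, ite_pow, one_pow, Finset.prod_ite_mem, Finset.univ_inter]
  rw [← Finset.smul_sum, mul_smul_comm, hσ σ, Finset.sum_mul]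

theorem sum_coeffA {N : ℕ} {q : ℂ} (hq : q ≠ 0) {z : Fin N → ℂ}
    (hz : Function.Injective z) (r : ℕ) :
    ∑ J ∈ Finset.univ.powersetCard r, coeffA q J z = qBinom q N r := by
  rcases Nat.eq_zero_or_pos N with rfl | hN
  · cases r with
    | zero => simp [coeffA, qBinom]
    | succ r => rw [Finset.powersetCard_eq_empty.mpr (by simp)]; simp [qBinom]
  have hdet : (Matrix.vandermonde z).det ≠ 0 := Matrix.det_vandermonde_ne_zero_iff.mpr hz
  have hpow : q ^ (r * (N - 1)) ≠ 0 := pow_ne_zero _ hq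
  have h := sum_det_vandermonde_scale q z r
  rw [sum_powersetCard_prod_pow hq] at h
  have hcast : q ^ ((r : ℤ) * (N - 1)) = q ^ (r * (N - 1)) := by
    rw [← zpow_natCast]
    congr 1
    push_cast [Nat.cast_sub hN]
    ring
  rw [hcast, Finset.sum_congr rfl fun J hJ => (det_vandermonde_scale hq hz J).trans (by
    rw [(Finset.mem_powersetCard.mp hJ).2]), ← Finset.sum_mul, ← Finset.mul_sum] at h
  exact mul_left_cancel₀ hpow (mul_right_cancel₀ hdet h)

end SpinChain

namespace SpinChain

/-! ### The evaluation point -/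

section EvPoint

variable {N : ℕ} {q : ℂ}

theorem evPoint_eq_pow (j : Fin N) :
    evPoint N j = Complex.exp (2 * Real.pi * Complex.I / N) ^ ((j : ℕ) + 1) := by
  rw [evPoint, ← Complex.exp_nat_mul]
  congr 1
  push_cast
  ring

theorem evPoint_pow (j : Fin N) : evPoint N j ^ N = 1 := by
  have hN : N ≠ 0 := (Fin.pos j).ne'
  rw [evPoint_eq_pow, ← pow_mul, mul_comm (_ + 1), pow_mul, (Complex.isPrimitiveRoot_exp N hN).pow_eq_one,
    one_pow]

theorem evPoint_injective : Function.Injective (evPoint N) := by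
  intro i j h
  have hN : N ≠ 0 := (Fin.pos j).ne'
  rw [evPoint_eq_pow, evPoint_eq_pow, pow_succ, pow_succ] at h
  exact Fin.ext ((Complex.isPrimitiveRoot_exp N hN).pow_inj i.2 j.2
    (mul_right_cancel₀ (Complex.exp_ne_zero _) h))

theorem evPoint_add [NeZero N] (j a : Fin N) : evPoint N (j + a)
    = Complex.exp (2 * Real.pi * Complex.I / N) ^ (a : ℕ) * evPoint N j := by
  have h := (Complex.isPrimitiveRoot_exp N (NeZero.ne N)).pow_eq_one
  rw [evPoint_eq_pow, evPoint_eq_pow, Fin.val_add, pow_succ, pow_succ, ← mul_assoc, ← pow_add,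
    add_comm (a : ℕ)]
  conv_rhs => rw [← Nat.mod_add_div ((j : ℕ) + a) N, pow_add, pow_mul, h, one_pow, mul_one]

/-- The evaluation point as a regular point. -/
noncomputable def evRegular (hq0 : q ≠ 0) (hq : q ^ (2 * N) ≠ 1) : RegularPoint N q where
  val := evPoint N
  ne' i j h := by
    apply hq
    -- A pole would make $q^2$ a ratio of two $N$-th roots of unity.
    have h1 : q ^ 2 * evPoint N i = evPoint N j := by
      have : q * (q * evPoint N i - q⁻¹ * evPoint N j) = q ^ 2 * evPoint N i - evPoint N j := by
        field_simp
      rw [h, mul_zero] at this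
      exact (sub_eq_zero.mp this.symm)
    have h2 := congrArg (· ^ N) h1
    simp only [mul_pow, evPoint_pow, mul_one] at h2
    rw [pow_mul, h2]

/-! ### Values of the coefficients at the evaluation point -/

theorem coeffA_map (J : Finset (Fin N)) (e : Equiv.Perm (Fin N)) (z : Fin N → ℂ) :
    coeffA q (J.map e.toEmbedding) z = coeffA q J (z ∘ e) := by
  have : (J.map e.toEmbedding)ᶜ = Jᶜ.map e.toEmbedding := by
    ext i
    simp
  simp [coeffA, this, Finset.prod_map]

theorem coeffA_smul (J : Finset (Fin N)) (z : Fin N → ℂ) {c : ℂ} (hc : c ≠ 0) :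
    coeffA q J (fun i => c * z i) = coeffA q J z := by
  refine Finset.prod_congr rfl fun j _ => Finset.prod_congr rfl fun k _ => ?_
  rw [← mul_sub, mul_left_comm, mul_left_comm q⁻¹, ← mul_sub, mul_div_mul_left _ _ hc]

/-- Translation of the indices modulo $N$ multiplies the evaluation point by a root of unity, which
does not change $A_J$. So the sum is the same for all $j$, and the total over $j$ counts each $A_J$
exactly $r$ times. -/
theorem sum_coeffA_evPoint_of_mem (hq : q ≠ 0) (r : ℕ) (j : Fin N) :
    ∑ J ∈ Finset.univ.powersetCard r, (if j ∈ J then coeffA q J (evPoint N) else 0)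
      = (r : ℂ) / N * qBinom q N r := by
  have hN : N ≠ 0 := (Fin.pos j).ne'
  have : NeZero N := ⟨hN⟩
  have hshift (i a : Fin N) :
      ∑ J ∈ Finset.univ.powersetCard r, (if i + a ∈ J then coeffA q J (evPoint N) else 0)
        = ∑ J ∈ Finset.univ.powersetCard r, (if i ∈ J then coeffA q J (evPoint N) else 0) := by
    conv_lhs => rw [← Finset.map_univ_equiv (Equiv.addRight a), Finset.powersetCard_map,
      Finset.sum_map]
    refine Finset.sum_congr rfl fun J _ => ?_
    have h1 : evPoint N ∘ Equiv.addRight a = fun i =>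
        Complex.exp (2 * Real.pi * Complex.I / N) ^ (a : ℕ) * evPoint N i :=
      funext fun i => evPoint_add i a
    have h2 := coeffA_map (q := q) J (Equiv.addRight a) (evPoint N)
    rw [h1, coeffA_smul _ _ (pow_ne_zero _ (Complex.exp_ne_zero _))] at h2
    simp only [RelEmbedding.coe_toEmbedding, Finset.mapEmbedding_apply, h2]
    simp
  have hconst (i : Fin N) :
      ∑ J ∈ Finset.univ.powersetCard r, (if i ∈ J then coeffA q J (evPoint N) else 0)
        = ∑ J ∈ Finset.univ.powersetCard r, (if j ∈ J then coeffA q J (evPoint N) else 0) := by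
    rw [← hshift j (i - j), add_sub_cancel]
  have htotal : ∑ i : Fin N,
      ∑ J ∈ Finset.univ.powersetCard r, (if i ∈ J then coeffA q J (evPoint N) else 0)
        = r * qBinom q N r := by
    rw [Finset.sum_comm, ← sum_coeffA hq evPoint_injective, Finset.mul_sum]
    refine Finset.sum_congr rfl fun J hJ => ?_
    rw [Finset.sum_ite_mem, Finset.univ_inter, Finset.sum_const,
      (Finset.mem_powersetCard.mp hJ).2, nsmul_eq_mul]
  rw [Finset.sum_congr rfl fun i _ => hconst i, Finset.sum_const, Finset.card_univ,
    Fintype.card_fin, nsmul_eq_mul] at htotal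
  have hN' : (N : ℂ) ≠ 0 := Nat.cast_ne_zero.mpr hN
  rw [div_mul_eq_mul_div, eq_div_iff hN', ← htotal, mul_comm]

theorem sub_inv_ne_zero (hq : q ≠ 0) (hq2 : q ^ 2 ≠ 1) : q - q⁻¹ ≠ 0 := by
  intro h
  apply hq2
  have : q * (q - q⁻¹) = q ^ 2 - 1 := by field_simp
  rw [h, mul_zero] at this
  exact sub_eq_zero.mp this.symm

theorem qBinom_one_right (hq : q ≠ 0) (hq2 : q ^ 2 ≠ 1) (n : ℕ) : qBinom q n 1 = qNum q n := by
  have h := prod_qNum_mul_qBinom q hq hq2 n 1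
  simpa [qNum, div_self (sub_inv_ne_zero hq hq2)] using h

theorem coeffA_singleton_evPoint (hq : q ≠ 0) (hq2 : q ^ 2 ≠ 1) (j : Fin N) :
    coeffA q {j} (evPoint N) = qNum q N / N := by
  have h := sum_coeffA_evPoint_of_mem hq 1 j
  rw [Finset.powersetCard_one, Finset.sum_map, qBinom_one_right hq hq2] at h
  simp only [Function.Embedding.coeFn_mk, Finset.mem_singleton, Finset.sum_ite_eq,
    Finset.mem_univ, if_true] at h
  rw [h]
  push_cast
  ring

theorem coeffA_compl_singleton (j : Fin N) (z : Fin N → ℂ) :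
    coeffA q {j}ᶜ z = coeffA q⁻¹ {j} z := by
  simp only [coeffA, compl_compl, Finset.prod_singleton, inv_inv]
  refine Finset.prod_congr rfl fun k _ => ?_
  rw [← neg_div_neg_eq]
  congr 1 <;> ring

theorem qNum_inv (m : ℤ) : qNum q⁻¹ m = qNum q m := by
  rw [qNum, qNum, inv_inv, inv_zpow', inv_zpow', neg_neg, ← neg_div_neg_eq]
  congr 1 <;> ring

theorem coeffA_compl_singleton_evPoint (hq : q ≠ 0) (hq2 : q ^ 2 ≠ 1) (j : Fin N) :
    coeffA q {j}ᶜ (evPoint N) = qNum q N / N := by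
  rw [coeffA_compl_singleton, coeffA_singleton_evPoint (inv_ne_zero hq) (by simpa using hq2),
    qNum_inv]

end EvPoint

/-! ### Logarithmic derivatives of operator-valued functions -/

/-- The operator-valued function `F` is invertible at `1` and has the derivative `F 1 * X` there. -/
def HasLogDeriv {N : ℕ} (F : ℂ → SpinOp N) (X : SpinOp N) : Prop :=
  IsUnit (F 1) ∧ ∀ σ τ, HasDerivAt (fun p => F p σ τ) ((F 1 * X) σ τ) 1

section LogDeriv

variable {N : ℕ} {q : ℂ}

theorem HasLogDeriv.one : HasLogDeriv (fun _ => (1 : SpinOp N)) 0 :=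
  ⟨isUnit_one, fun σ τ => by simpa using hasDerivAt_const (1 : ℂ) ((1 : SpinOp N) σ τ)⟩

theorem inv_mul_of_isUnit {A : SpinOp N} (h : IsUnit A) : A⁻¹ * A = 1 :=
  Matrix.nonsing_inv_mul _ ((Matrix.isUnit_iff_isUnit_det _).mp h)

theorem mul_inv_of_isUnit {A : SpinOp N} (h : IsUnit A) : A * A⁻¹ = 1 :=
  Matrix.mul_nonsing_inv _ ((Matrix.isUnit_iff_isUnit_det _).mp h)

theorem HasLogDeriv.mul {F G : ℂ → SpinOp N} {X Y : SpinOp N} (hF : HasLogDeriv F X)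
    (hG : HasLogDeriv G Y) :
    HasLogDeriv (fun p => F p * G p) ((G 1)⁻¹ * X * G 1 + Y) := by
  refine ⟨hF.1.mul hG.1, fun σ τ => ?_⟩
  have h := HasDerivAt.fun_sum fun ρ (_ : ρ ∈ Finset.univ) => (hF.2 σ ρ).mul (hG.2 ρ τ)
  simp only [Matrix.mul_apply (M := F _)]
  have e : F 1 * G 1 * ((G 1)⁻¹ * X * G 1 + Y) = F 1 * X * G 1 + F 1 * (G 1 * Y) := by
    rw [mul_add, mul_assoc (F 1), ← mul_assoc (G 1), ← mul_assoc (G 1), mul_inv_of_isUnit hG.1,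
      one_mul, mul_assoc (F 1), mul_assoc (F 1) X]
  refine h.congr_deriv ?_
  rw [e, Finset.sum_add_distrib]
  rfl

theorem HasLogDeriv.unique {F : ℂ → SpinOp N} {X Y : SpinOp N} (hX : HasLogDeriv F X)
    (hY : HasLogDeriv F Y) : X = Y := by
  have h : F 1 * X = F 1 * Y := Matrix.ext fun σ τ => (hX.2 σ τ).unique (hY.2 σ τ)
  exact hX.1.mul_left_cancel h

theorem exists_hasLogDeriv_list_prod {ι : Type*} (F : ι → ℂ → SpinOp N) (L : List ι)
    (h : ∀ i ∈ L, ∃ X, HasLogDeriv (F i) X) :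
    ∃ X, HasLogDeriv (fun p => (L.map fun i => F i p).prod) X := by
  induction L with
  | nil => exact ⟨0, by simpa using HasLogDeriv.one⟩
  | cons a L ih =>
    obtain ⟨X, hX⟩ := h a (by simp)
    obtain ⟨Y, hY⟩ := ih fun i hi => h i (by simp [hi])
    exact ⟨_, by simpa using hX.mul hY⟩

/-- The logarithmic derivative of a product over a list that increases with respect to `r`: each
summand is conjugated by the product of the factors after it. -/
theorem HasLogDeriv.list_prod {ι : Type*} (r : ι → ι → Prop) [DecidableRel r]
    (hr : ∀ i j, r i j → ¬ r j i) (F : ι → ℂ → SpinOp N) (X : ι → SpinOp N) (L : List ι)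
    (hL : L.Pairwise r) (h : ∀ i ∈ L, HasLogDeriv (F i) (X i)) :
    HasLogDeriv (fun p => (L.map fun i => F i p).prod)
      (L.map fun i => (((L.filter fun j => r i j).map fun j => F j 1).prod)⁻¹ * X i
        * ((L.filter fun j => r i j).map fun j => F j 1).prod).sum := by
  induction L with
  | nil => simpa using HasLogDeriv.one
  | cons a L ih =>
    rw [List.pairwise_cons] at hL
    have h1 := (h a (by simp)).mul (ih hL.2 fun i hi => h i (by simp [hi]))
    have e1 : (a :: L).filter (fun j => r a j) = L := by
      rw [List.filter_cons_of_neg (by simpa using fun h => hr _ _ h h)]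
      exact List.filter_eq_self.mpr fun j hj => by simpa using hL.1 j hj
    have e2 : ∀ i ∈ L, (a :: L).filter (fun j => r i j) = L.filter (fun j => r i j) := by
      intro i hi
      exact List.filter_cons_of_neg (by simpa using hr _ _ (hL.1 i hi))
    simp only [List.map_cons, List.prod_cons, List.sum_cons]
    have e3 : (L.map fun i => ((((a :: L).filter fun j => r i j).map fun j => F j 1).prod)⁻¹ * X i
        * (((a :: L).filter fun j => r i j).map fun j => F j 1).prod)
        = L.map fun i => (((L.filter fun j => r i j).map fun j => F j 1).prod)⁻¹ * X i
        * ((L.filter fun j => r i j).map fun j => F j 1).prod :=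
      List.map_congr_left fun i hi => by simp only [e2 i hi]
    rw [e1, e3]
    exact h1

/-- The potential arises here. With $\check R=1-fe$ and $a=qx-q^{-1}y$, $b=qy-q^{-1}x$, the
derivative of $f$ at $p=1$ is $-(q-q^{-1})xy/a^2$, while $e^2=(q+q^{-1})e$ gives $\check Re=(b/a)e$.
The quotient of the two coefficients is $(q-q^{-1})xy/(ab)$. -/
theorem hasLogDeriv_onPair_Rcheck (hq : q ≠ 0) (k : ℕ) {x y : ℂ} (hx : x ≠ 0) (hy : y ≠ 0)
    (h1 : q * x - q⁻¹ * y ≠ 0) (h2 : q * y - q⁻¹ * x ≠ 0) :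
    HasLogDeriv (fun p => onPair N k (Rcheck q (x / (p * y))))
      (((q - q⁻¹) * potential q x y) • tl N q k) := by
  have hev : ∀ᶠ p : ℂ in nhds 1, p ≠ 0 ∧ q * x - q⁻¹ * (p * y) ≠ 0 := by
    refine (isOpen_ne.eventually_mem one_ne_zero).and ?_
    have : Continuous fun p : ℂ => q * x - q⁻¹ * (p * y) := by fun_prop
    exact this.continuousAt.eventually_ne (by simpa using h1)
  have heq {p : ℂ} (hp : p ≠ 0 ∧ q * x - q⁻¹ * (p * y) ≠ 0) :
      onPair N k (Rcheck q (x / (p * y)))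
        = 1 - ((x - p * y) / (q * x - q⁻¹ * (p * y))) • tl N q k := by
    have hpy : p * y ≠ 0 := mul_ne_zero hp.1 hy
    have e : q * (x / (p * y)) - q⁻¹ = (q * x - q⁻¹ * (p * y)) / (p * y) := by
      rw [eq_div_iff hpy, sub_mul, mul_assoc, div_mul_cancel₀ _ hpy]
    rw [onPair_Rcheck _ _ _ (by rw [e]; exact div_ne_zero hp.2 hpy), fFun, e, div_sub_one hpy,
      div_div_div_cancel_right₀ hpy]
  have heq1 := heq (p := 1) ⟨one_ne_zero, by simpa using h1⟩
  refine ⟨?_, fun σ τ => ?_⟩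
  · have hu : x / (1 * y) ≠ 0 := by simpa using ⟨hx, hy⟩
    have e1 : q * (x / (1 * y)) - q⁻¹ ≠ 0 := by
      have : q * (x / (1 * y)) - q⁻¹ = (q * x - q⁻¹ * y) / y := by field_simp
      rw [this]
      exact div_ne_zero h1 hy
    have e2 : q - q⁻¹ * (x / (1 * y)) ≠ 0 := by
      have : q - q⁻¹ * (x / (1 * y)) = (q * y - q⁻¹ * x) / y := by field_simp
      rw [this]
      exact div_ne_zero h2 hy
    simp only [onPair_Rcheck _ _ _ e1]
    exact IsUnit.of_mul_eq_one _ (rOp_mul_rOp_inv hq hu e1 e2 k)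
  · have hd : HasDerivAt (fun p : ℂ => (x - p * y) / (q * x - q⁻¹ * (p * y)))
        (-((q - q⁻¹) * (x * y)) / (q * x - q⁻¹ * y) ^ 2) 1 := by
      have hn : HasDerivAt (fun p : ℂ => x - p * y) (-y) 1 := by
        simpa using ((hasDerivAt_id (1 : ℂ)).mul_const y).const_sub x
      have hdn : HasDerivAt (fun p : ℂ => q * x - q⁻¹ * (p * y)) (-(q⁻¹ * y)) 1 := by
        simpa using (((hasDerivAt_id (1 : ℂ)).mul_const y).const_mul q⁻¹).const_sub (q * x)
      refine (hn.fun_div hdn (by simpa using h1)).congr_deriv ?_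
      simp only [one_mul]
      congr 1
      ring
    have hd' := (hasDerivAt_const (1 : ℂ) ((1 : SpinOp N) σ τ)).sub
      (hd.mul_const (tl N q k σ τ))
    refine (hd'.congr_of_eventuallyEq ?_).congr_deriv ?_
    · filter_upwards [hev] with p hp
      rw [heq hp]
      rfl
    · have hX : onPair N k (Rcheck q (x / (1 * y))) * (((q - q⁻¹) * potential q x y) • tl N q k)
          = ((q - q⁻¹) * potential q x y * (1 - (x - y) / (q * x - q⁻¹ * y) * (q + q⁻¹)))
            • tl N q k := by
        rw [heq1, one_mul]
        simp only [sub_mul, one_mul, smul_mul_assoc, mul_smul_comm, tl_sq hq, smul_smul]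
        module
      rw [hX, Matrix.smul_apply, smul_eq_mul, zero_sub, ← neg_mul, potential]
      congr 1
      have e3 : 1 - (x - y) / (q * x - q⁻¹ * y) * (q + q⁻¹)
          = (q * y - q⁻¹ * x) / (q * x - q⁻¹ * y) := by
        rw [eq_div_iff h1, sub_mul, mul_right_comm, div_mul_cancel₀ _ h1]
        ring
      rw [e3, neg_div, neg_neg]
      generalize q * x - q⁻¹ * y = a at *
      generalize q * y - q⁻¹ * x = b at *
      field_simp

end LogDeriv

end SpinChain

namespace SpinChain

variable {N : ℕ} {q : ℂ}

/-! ### Logarithmic derivatives of the operators `Ř_J` -/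

theorem filter_finRange_eq_singleton (p : Fin N → Bool) (k : Fin N) (h : ∀ i, p i = true ↔ i = k) :
    (List.finRange N).filter p = [k] := by
  have : (List.finRange N).filter p = (List.finRange N).filter (· == k) :=
    List.filter_congr fun i _ => by rw [Bool.eq_iff_iff, h]; simp
  rw [this, List.filter_beq, List.count_eq_one_of_mem (List.nodup_finRange N) (List.mem_finRange k)]
  rfl

theorem list_prod_map_ite {M ι : Type*} [Monoid M] (p : ι → Bool) (f : ι → M) (L : List ι) :
    (L.map fun i => if p i then f i else 1).prod = ((L.filter p).map f).prod := by
  induction L with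
  | nil => rfl
  | cons a L ih => by_cases h : p a <;> simp [h, ih]

theorem pairwise_finRange : (List.finRange N).Pairwise (· < ·) := List.pairwise_lt_finRange N

namespace RegularPoint

/-- The coordinates in `J` are multiplied by `p`. -/
def scale (z : RegularPoint N q) (J : Finset (Fin N)) (p : ℂ) : Fin N → ℂ :=
  fun k => if k ∈ J then p * z.val k else z.val k

theorem scale_one (z : RegularPoint N q) (J : Finset (Fin N)) : z.scale J 1 = z.val := by
  funext k
  simp [scale]

theorem inv_onPair_Rcheck (hq : q ≠ 0) (z : RegularPoint N q) (k : ℕ) (i j : Fin N) :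
    (onPair N k (Rcheck q (z.val i / z.val j)))⁻¹ = onPair N k (Rcheck q (z.val j / z.val i)) := by
  have h := rOp_mul_rOp_inv (N := N) hq (div_ne_zero (z.ne_zero i) (z.ne_zero j)) (z.ratio_ne i j)
    (z.ratio_ne' i j) k
  rw [onPair_Rcheck _ _ _ (z.ratio_ne i j), onPair_Rcheck _ _ _ (z.ratio_ne j i)]
  rw [inv_div] at h
  exact Matrix.inv_eq_right_inv h

theorem hasLogDeriv_onPair (hq : q ≠ 0) (z : RegularPoint N q) (k : ℕ) {J : Finset (Fin N)}
    {i j : Fin N} (hi : i ∉ J) (hj : j ∈ J) :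
    HasLogDeriv (fun p => onPair N k (Rcheck q (z.scale J p i / z.scale J p j)))
      (((q - q⁻¹) * potential q (z.val i) (z.val j)) • tl N q k) := by
  simp only [scale, hi, hj, if_true, if_false]
  exact hasLogDeriv_onPair_Rcheck hq k (z.ne_zero i) (z.ne_zero j) (z.ne' i j) (z.ne' j i)

/-- Every crossing in $\check R_J$ involves one line outside $J$ and one in $J$, so exactly one of
its two parameters is scaled. -/
theorem exists_hasLogDeriv_RJ (hq : q ≠ 0) (z : RegularPoint N q) (J : Finset (Fin N)) :
    ∃ X, HasLogDeriv (fun p => RJ q J (z.scale J p)) X := by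
  refine exists_hasLogDeriv_list_prod (fun j p => layer q J (z.scale J p) j) _ fun j hj => ?_
  refine exists_hasLogDeriv_list_prod
    (fun i p => onPair N (crossPos J i j) (Rcheck q (z.scale J p i / z.scale J p j))) _
    fun i hi => ?_
  simp only [List.mem_reverse, List.mem_filter, decide_eq_true_eq] at hi hj
  exact ⟨_, z.hasLogDeriv_onPair hq _ hi.2.1 hj.2⟩

theorem RJ_singleton (j : Fin N) (w : Fin N → ℂ) : RJ q {j} w
    = (((List.finRange N).filter fun i => i < j).map fun i : Fin N =>
        onPair N i (Rcheck q (w i / w j))).prod := by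
  rw [RJ, filter_finRange_eq_singleton _ j (by simp)]
  simp only [List.reverse_singleton, List.map_singleton, List.prod_singleton, layer]
  have e : (List.finRange N).filter (fun i => decide (i ∉ ({j} : Finset (Fin N)) ∧ i < j))
      = (List.finRange N).filter fun i => decide (i < j) := by
    refine List.filter_congr fun i _ => ?_
    simp only [Finset.mem_singleton, decide_eq_decide, and_iff_right_iff_imp]
    exact fun h => h.ne
  rw [e]
  congr 1
  refine List.map_congr_left fun i hi => ?_
  have hij : i < j := by simpa using (List.mem_filter.mp hi).2
  have h1 : ({j} : Finset (Fin N)).filter (fun k => k < j) = ∅ := by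
    ext k
    simp only [Finset.mem_filter, Finset.mem_singleton, Finset.notMem_empty, iff_false]
    rintro ⟨rfl, h⟩
    exact lt_irrefl _ h
  have h2 : ({j}ᶜ : Finset (Fin N)).filter (fun k => k < i) = Finset.Iio i := by
    ext k
    simp only [Finset.mem_filter, Finset.mem_compl, Finset.mem_singleton, Finset.mem_Iio,
      and_iff_right_iff_imp]
    rintro h rfl
    exact lt_asymm h hij
  rw [crossPos, h1, h2, Finset.card_empty, Fin.card_Iio, zero_add]

theorem hasLogDeriv_RJ_singleton (hq : q ≠ 0) (z : RegularPoint N q) (j : Fin N) :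
    HasLogDeriv (fun p => RJ q {j} (z.scale {j} p))
      (∑ i ∈ Finset.Iio j, ((q - q⁻¹) * potential q (z.val i) (z.val j)) • SL q z.val i j) := by
  have h := HasLogDeriv.list_prod (N := N) (fun i j : Fin N => i < j) (fun _ _ => lt_asymm)
    (fun i p => onPair N i (Rcheck q (z.scale {j} p i / z.scale {j} p j)))
    (fun i => ((q - q⁻¹) * potential q (z.val i) (z.val j)) • tl N q i)
    ((List.finRange N).filter fun i => i < j) (pairwise_finRange.filter _) (by
      intro i hi
      have hij : i < j := by simpa using (List.mem_filter.mp hi).2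
      exact z.hasLogDeriv_onPair hq _ (by simpa using hij.ne) (by simp))
  simp only [← RJ_singleton] at h
  convert h using 1
  rw [← List.sum_toFinset _ ((List.nodup_finRange N).filter _)]
  refine Finset.sum_congr (by ext i; simp) fun i hi => ?_
  have hij : i < j := by simpa using hi
  -- The factors to the right of crossing $i$ are those of the sites strictly between $i$ and $j$.
  -- Conjugation by them is the transport in $S^{\mathrm L}_{[i,j]}$.
  have e : (((List.finRange N).filter fun i => i < j).filter fun k => i < k) = between i j := by
    rw [List.filter_filter, between]
    exact List.filter_congr fun k _ => by simp
  have htl : onPair N i (eTL q) = tl N q i := by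
    rw [tl, if_pos (by omega)]
  rw [e, Matrix.list_prod_inv_reverse, SL, htl, scale_one, ← List.map_reverse, List.map_map]
  simp only [mul_smul_comm, smul_mul_assoc, Function.comp_def, z.inv_onPair_Rcheck hq]

/-- Only the line of $z_k$ is crossed. Layers with $j<k$ are empty, and those with $j>k$ have one
crossing, at $j-1$ because $k$ is missing among the lines of $J$ to the left of $j$. -/
theorem RJ_compl_singleton (k : Fin N) (w : Fin N → ℂ) : RJ q {k}ᶜ w
    = (((List.finRange N).filter fun j => k < j).reverse.map fun j : Fin N =>
        onPair N ((j : ℕ) - 1) (Rcheck q (w k / w j))).prod := by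
  have hlayer : ∀ j ∈ ((List.finRange N).filter fun j => j ∈ ({k}ᶜ : Finset (Fin N))).reverse,
      layer q {k}ᶜ w j = if decide (k < j) then onPair N ((j : ℕ) - 1) (Rcheck q (w k / w j))
        else 1 := by
    intro j _
    by_cases hkj : k < j
    · rw [layer, filter_finRange_eq_singleton _ k (by
        intro i
        simp only [Finset.mem_compl, Finset.mem_singleton, not_not, decide_eq_true_eq]
        exact ⟨fun h => h.1, fun h => ⟨h, h ▸ hkj⟩⟩)]
      have h1 : ({k}ᶜ : Finset (Fin N)).filter (fun i => i < j) = (Finset.Iio j).erase k := by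
        ext i
        simp
      have h2 : ({k} : Finset (Fin N)).filter (fun i => i < k) = ∅ := by
        ext i
        simp only [Finset.mem_filter, Finset.mem_singleton, Finset.notMem_empty, iff_false]
        rintro ⟨rfl, h⟩
        exact lt_irrefl _ h
      simp [hkj, crossPos, h1, h2, Finset.card_erase_of_mem]
    · have e : (List.finRange N).filter (fun i => decide (i ∉ ({k}ᶜ : Finset (Fin N)) ∧ i < j))
          = [] := by
        refine List.filter_eq_nil_iff.mpr fun i _ => ?_
        simp only [Finset.mem_compl, Finset.mem_singleton, not_not, decide_eq_true_eq]
        rintro ⟨rfl, h⟩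
        exact hkj h
      rw [layer, e]
      simp [hkj]
  rw [RJ, List.map_congr_left hlayer, list_prod_map_ite, List.filter_reverse, List.filter_filter]
  have e : (List.finRange N).filter (fun j => decide (k < j) && decide (j ∈ ({k}ᶜ : Finset (Fin N))))
      = (List.finRange N).filter fun j => decide (k < j) := by
    refine List.filter_congr fun j _ => ?_
    rw [Bool.eq_iff_iff]
    simp only [Finset.mem_compl, Finset.mem_singleton, Bool.and_eq_true, decide_eq_true_eq,
      and_iff_left_iff_imp]
    exact fun h => h.ne'
  rw [e]

theorem hasLogDeriv_RJ_compl_singleton (hq : q ≠ 0) (z : RegularPoint N q) (k : Fin N) :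
    HasLogDeriv (fun p => RJ q {k}ᶜ (z.scale {k}ᶜ p))
      (∑ j ∈ Finset.Ioi k, ((q - q⁻¹) * potential q (z.val k) (z.val j)) • SR q z.val k j) := by
  have h := HasLogDeriv.list_prod (N := N) (fun i j : Fin N => j < i) (fun _ _ => lt_asymm)
    (fun j p => onPair N ((j : ℕ) - 1) (Rcheck q (z.scale {k}ᶜ p k / z.scale {k}ᶜ p j)))
    (fun j => ((q - q⁻¹) * potential q (z.val k) (z.val j)) • tl N q ((j : ℕ) - 1))
    ((List.finRange N).filter fun j => k < j).reverse
    (List.pairwise_reverse.mpr (pairwise_finRange.filter _)) (by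
      intro j hj
      have hkj : k < j := by simpa using hj
      exact z.hasLogDeriv_onPair hq _ (by simp) (by simpa using hkj.ne'))
  simp only [← RJ_compl_singleton] at h
  convert h using 1
  rw [← List.sum_toFinset _ (List.nodup_reverse.mpr ((List.nodup_finRange N).filter _))]
  refine Finset.sum_congr (by ext i; simp) fun j hj => ?_
  have hkj : k < j := by simpa using hj
  have e : (((List.finRange N).filter fun j => k < j).reverse.filter fun i => i < j)
      = (between k j).reverse := by
    rw [List.filter_reverse, List.filter_filter, between]
    congr 1
    exact List.filter_congr fun i _ => by simp [Bool.and_comm]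
  have htl : onPair N ((j : ℕ) - 1) (eTL q) = tl N q ((j : ℕ) - 1) := by
    rw [tl, if_pos (by omega)]
  rw [e, Matrix.list_prod_inv_reverse, SR, htl, scale_one, ← List.map_reverse, List.reverse_reverse,
    List.map_map]
  simp only [mul_smul_comm, smul_mul_assoc, Function.comp_def, z.inv_onPair_Rcheck hq]

/-! ### Derivatives of the spin-Macdonald operators -/

/-- One family $d_j=z_j\partial_j\Psi$ serves all $J$ at once. This is what allows the derivative
terms of different $J$ to be collected by $j$. -/
theorem exists_hasDerivAt_evalVec (z : RegularPoint N q) (Ψ : PolyVec N) :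
    ∃ d : Fin N → SpinSpace N, ∀ J : Finset (Fin N),
      HasDerivAt (fun p => evalVec Ψ (z.scale J p)) (∑ j ∈ J, d j) 1 := by
  have hpoly (f : MvPolynomial (Fin N) ℂ) : ∃ d : Fin N → ℂ, ∀ J : Finset (Fin N),
      HasDerivAt (fun p => MvPolynomial.eval (z.scale J p) f) (∑ j ∈ J, d j) 1 := by
    induction f using MvPolynomial.induction_on with
    | C a => exact ⟨0, fun J => by simpa using hasDerivAt_const (1 : ℂ) a⟩
    | add f g hf hg =>
      obtain ⟨d, hd⟩ := hf
      obtain ⟨d', hd'⟩ := hg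
      refine ⟨fun j => d j + d' j, fun J => ?_⟩
      simpa only [map_add, Finset.sum_add_distrib] using (hd J).fun_add (hd' J)
    | mul_X f i hf =>
      obtain ⟨d, hd⟩ := hf
      refine ⟨fun j => d j * z.val i
        + MvPolynomial.eval z.val f * (if j = i then z.val i else 0), fun J => ?_⟩
      have hX : HasDerivAt (fun p => z.scale J p i) (∑ j ∈ J, if j = i then z.val i else 0) 1 := by
        by_cases hi : i ∈ J
        · simpa [scale, hi] using (hasDerivAt_id (1 : ℂ)).mul_const (z.val i)
        · simpa [scale, hi] using hasDerivAt_const (1 : ℂ) (z.val i)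
      have h := (hd J).fun_mul hX
      simp only [scale_one] at h
      simpa only [map_mul, MvPolynomial.eval_X, Finset.sum_add_distrib, ← Finset.sum_mul,
        ← Finset.mul_sum] using h
  choose d hd using hpoly
  refine ⟨fun j σ => d (Ψ σ) j, fun J => hasDerivAt_pi.mpr fun σ => ?_⟩
  rw [Finset.sum_apply]
  exact hd (Ψ σ) J

theorem hasDerivAt_mulVec {F : ℂ → SpinOp N} {X : SpinOp N} (hF : HasLogDeriv F X)
    {v : ℂ → SpinSpace N} {v' : SpinSpace N} (hv : HasDerivAt v v' 1) :
    HasDerivAt (fun p => (F 1)⁻¹ *ᵥ (F p *ᵥ v p)) (X *ᵥ v 1 + v') 1 := by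
  have h1 : HasDerivAt (fun p => F p *ᵥ v p) (F 1 *ᵥ (X *ᵥ v 1 + v')) 1 := by
    refine hasDerivAt_pi.mpr fun σ => ?_
    have h := HasDerivAt.fun_sum fun τ (_ : τ ∈ Finset.univ) =>
      (hF.2 σ τ).fun_mul (hasDerivAt_pi.mp hv τ)
    refine h.congr_deriv ?_
    rw [Finset.sum_add_distrib, Matrix.mulVec_add, Matrix.mulVec_mulVec]
    rfl
  have h2 : HasDerivAt (fun p => (F 1)⁻¹ *ᵥ (F p *ᵥ v p))
      ((F 1)⁻¹ *ᵥ (F 1 *ᵥ (X *ᵥ v 1 + v'))) 1 := by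
    refine hasDerivAt_pi.mpr fun σ => ?_
    exact HasDerivAt.fun_sum fun τ _ => (hasDerivAt_pi.mp h1 τ).const_mul _
  rwa [Matrix.mulVec_mulVec, inv_mul_of_isUnit hF.1, Matrix.one_mulVec] at h2

/-- The logarithmic derivative at `p = 1` of `Ř_J`, when `p` scales the coordinates in `J`. -/
noncomputable def logDerivRJ (hq : q ≠ 0) (z : RegularPoint N q) (J : Finset (Fin N)) : SpinOp N :=
  (z.exists_hasLogDeriv_RJ hq J).choose

theorem hasLogDeriv_logDerivRJ (hq : q ≠ 0) (z : RegularPoint N q) (J : Finset (Fin N)) :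
    HasLogDeriv (fun p => RJ q J (z.scale J p)) (z.logDerivRJ hq J) :=
  (z.exists_hasLogDeriv_RJ hq J).choose_spec

theorem hasDerivAt_spinMacdonald (hq : q ≠ 0) (z : RegularPoint N q) (r : ℕ) (Ψ : PolyVec N)
    {d : Fin N → SpinSpace N} (hd : ∀ J : Finset (Fin N),
      HasDerivAt (fun p => evalVec Ψ (z.scale J p)) (∑ j ∈ J, d j) 1) :
    HasDerivAt (fun p => spinMacdonald q p r (evalVec Ψ) z.val)
      ((∑ J ∈ Finset.univ.powersetCard r, coeffA q J z.val • z.logDerivRJ hq J) *ᵥ evalVec Ψ z.val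
        + ∑ j, (∑ J ∈ Finset.univ.powersetCard r, if j ∈ J then coeffA q J z.val else 0) • d j)
      1 := by
  have h := HasDerivAt.fun_sum fun J (_ : J ∈ Finset.univ.powersetCard r) =>
    (hasDerivAt_mulVec (z.hasLogDeriv_logDerivRJ hq J) (hd J)).fun_const_smul (coeffA q J z.val)
  simp only [scale_one] at h
  refine h.congr_deriv ?_
  rw [Matrix.sum_mulVec]
  simp only [smul_add, Finset.sum_add_distrib, Matrix.smul_mulVec, Finset.sum_smul]
  congr 1
  rw [Finset.sum_comm]
  refine Finset.sum_congr rfl fun J _ => ?_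
  simp only [ite_smul, zero_smul, Finset.sum_ite_mem, Finset.univ_inter, Finset.smul_sum]

end RegularPoint

/-! ### The frozen Hamiltonians -/

/-- The operator `H_r`. -/
noncomputable def frozenHamiltonian (hq0 : q ≠ 0) (hq : q ^ (2 * N) ≠ 1) (r : ℕ) : SpinOp N :=
  (q - q⁻¹)⁻¹ • ∑ J ∈ Finset.univ.powersetCard r,
    coeffA q J (evPoint N) • (evRegular hq0 hq).logDerivRJ hq0 J

theorem sq_ne_one_of_pow_ne_one (hq : q ^ (2 * N) ≠ 1) : q ^ 2 ≠ 1 := fun h =>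
  hq (by rw [pow_mul, h, one_pow])

theorem isFrozen_frozenHamiltonian (hq0 : q ≠ 0) (hq : q ^ (2 * N) ≠ 1) (r : ℕ) :
    IsFrozen q r Set.univ (frozenHamiltonian hq0 hq r) := by
  intro Ψ _
  obtain ⟨d, hd⟩ := (evRegular hq0 hq).exists_hasDerivAt_evalVec Ψ
  have h1 := (evRegular hq0 hq).hasDerivAt_spinMacdonald hq0 r Ψ hd
  have h2 := (evRegular hq0 hq).hasDerivAt_spinMacdonald hq0 N Ψ hd
  have h := ((h1.fun_sub (h2.fun_const_smul ((r : ℂ) / N * qBinom q N r))).fun_const_smul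
    (q - q⁻¹)⁻¹)
  refine h.congr_deriv ?_
  have huniv : (Finset.univ : Finset (Fin N)).powersetCard N = {Finset.univ} := by
    simpa using Finset.powersetCard_self (Finset.univ : Finset (Fin N))
  -- For $J=\{1,\dots,N\}$ there are no lines to cross.
  have hR : (evRegular hq0 hq).logDerivRJ hq0 Finset.univ = 0 := by
    refine ((evRegular hq0 hq).hasLogDeriv_logDerivRJ hq0 Finset.univ).unique ?_
    have : ∀ w : Fin N → ℂ, RJ q Finset.univ w = 1 := by
      intro w
      rw [RJ]
      refine List.prod_eq_one fun A hA => ?_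
      obtain ⟨j, _, rfl⟩ := List.mem_map.mp hA
      simp [layer]
    simp only [this]
    exact HasLogDeriv.one
  have hev : (evRegular hq0 hq).val = evPoint N := rfl
  have hA : coeffA q (Finset.univ : Finset (Fin N)) (evPoint N) = 1 := by simp [coeffA]
  simp only [hev, sum_coeffA_evPoint_of_mem hq0, huniv, Finset.sum_singleton, hR, smul_zero,
    Matrix.zero_mulVec, zero_add, Finset.mem_univ, if_true, hA, one_smul, Finset.smul_sum,
    add_sub_cancel_right]
  rw [frozenHamiltonian, Matrix.smul_mulVec]

/-- Logarithmic derivatives are unique, so the chosen one is the explicit sum of the $S^{\mathrm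
L}$. All $A_{\{j\}}$ equal $[N]/N$ at the evaluation point, and $(q-q^{-1})^{-1}$ cancels. -/
theorem frozenHamiltonian_one (hq0 : q ≠ 0) (hq : q ^ (2 * N) ≠ 1) :
    frozenHamiltonian hq0 hq 1 = HL N q := by
  have hq2 := sq_ne_one_of_pow_ne_one hq
  have hX (j : Fin N) := ((evRegular hq0 hq).hasLogDeriv_logDerivRJ hq0 {j}).unique
    ((evRegular hq0 hq).hasLogDeriv_RJ_singleton hq0 j)
  rw [frozenHamiltonian, HL, Finset.powersetCard_one, Finset.sum_map]
  simp only [Function.Embedding.coeFn_mk, hX, coeffA_singleton_evPoint hq0 hq2]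
  rw [← Finset.smul_sum, smul_comm]
  congr 1
  simp only [mul_smul, ← Finset.smul_sum, inv_smul_smul₀ (sub_inv_ne_zero hq0 hq2)]
  refine Finset.sum_comm' fun i j => ?_
  simp

theorem frozenHamiltonian_pred (hq0 : q ≠ 0) (hq : q ^ (2 * N) ≠ 1) (hN : 1 ≤ N) :
    frozenHamiltonian hq0 hq (N - 1) = HR N q := by
  have hq2 := sq_ne_one_of_pow_ne_one hq
  have hX (k : Fin N) := ((evRegular hq0 hq).hasLogDeriv_logDerivRJ hq0 {k}ᶜ).unique
    ((evRegular hq0 hq).hasLogDeriv_RJ_compl_singleton hq0 k)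
  have hsum (f : Finset (Fin N) → SpinOp N) :
      ∑ J ∈ Finset.univ.powersetCard (N - 1), f J = ∑ k : Fin N, f {k}ᶜ := by
    symm
    refine Finset.sum_bij (fun k _ => {k}ᶜ) (fun k _ => ?_) (fun k _ l _ h => ?_) (fun J hJ => ?_)
      fun _ _ => rfl
    · simp [Finset.mem_powersetCard, Finset.card_compl]
    · simpa using h
    · have hc : Jᶜ.card = 1 := by
        rw [Finset.card_compl, (Finset.mem_powersetCard.mp hJ).2, Fintype.card_fin]
        omega
      obtain ⟨k, hk⟩ := Finset.card_eq_one.mp hc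
      exact ⟨k, Finset.mem_univ k, by rw [← hk, compl_compl]⟩
  rw [frozenHamiltonian, HR, hsum]
  simp only [hX, coeffA_compl_singleton_evPoint hq0 hq2]
  rw [← Finset.smul_sum, smul_comm]
  congr 1
  simp only [mul_smul, ← Finset.smul_sum, inv_smul_smul₀ (sub_inv_ne_zero hq0 hq2)]
  rfl

theorem eq_of_isFrozen_physicalSpace (hN : 1 ≤ N) (hq0 : q ≠ 0) (hq : q ^ (2 * N) ≠ 1) {r : ℕ}
    {H H' : SpinOp N} (hH : IsFrozen q r (physicalSpace N q) H)
    (hH' : IsFrozen q r (physicalSpace N q) H') : H' = H := by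
  refine matrix_ext_mulVec fun v => ?_
  obtain ⟨Ψ, hΨ, c, hc, hv⟩ := exists_physical hN hq0 (evRegular hq0 hq) evPoint_injective v
  have h := (hH' Ψ hΨ).unique (hH Ψ hΨ)
  rw [show evalVec Ψ (evPoint N) = c • v from hv, Matrix.mulVec_smul, Matrix.mulVec_smul] at h
  exact smul_right_injective _ hc h

end SpinChain

theorem theorem1p12 (N : ℕ) (hN : 1 ≤ N) (q : ℂ) (hq0 : q ≠ 0) (hq : q ^ (2 * N) ≠ 1) :
    ∃ H : ℕ → SpinChain.SpinOp N,
      (∀ r : ℕ, 1 ≤ r → r ≤ N →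
        SpinChain.IsFrozen q r Set.univ (H r) ∧
        ∀ H' : SpinChain.SpinOp N,
          SpinChain.IsFrozen q r (SpinChain.physicalSpace N q) H' → H' = H r) ∧
      H 1 = SpinChain.HL N q ∧
      (2 ≤ N → H (N - 1) = SpinChain.HR N q) := by
  refine ⟨SpinChain.frozenHamiltonian hq0 hq, fun r _ _ => ?_,
    SpinChain.frozenHamiltonian_one hq0 hq, fun _ => SpinChain.frozenHamiltonian_pred hq0 hq hN⟩
  have h := SpinChain.isFrozen_frozenHamiltonian hq0 hq r
  exact ⟨h, fun H' hH' => SpinChain.eq_of_isFrozen_physicalSpace hN hq0 hq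
    (fun Ψ _ => h Ψ (Set.mem_univ Ψ)) hH'⟩
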